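/- Let $\mathbb F$ be a field of characteristic not $2$. Algebras over $\mathbb F$ are vector spaces with a bilinear product $[\cdot,\cdot]$, not assumed associative. An algebra $\mathbf A$ is anticommutative if $[x,y]=-[y,x]$ for all $x,y$. It is nilpotent if $\mathbf A^n=0$ for some $n\ge 1$, where $\mathbf A^1=\mathbf A$ and $\mathbf A^{n+1}=[\mathbf A^n,\mathbf A^1]+[\mathbf A^{n-1},\mathbf A^2]+\cdots+[\mathbf A^1,\mathbf A^n]$. An anticommutative algebra is a Malcev algebra if $\mathcal J(x,y,[x,z])=[\mathcal J(x,y,z),x]$ for all $x,y,z$, where $\mathcal J(x,y,z)=[[x,y],z]+[[y,z],x]+[[z,x],y]$. An algebra is a $\mathfrak{CD}$-algebra if $T_xT_y-T_yT_x$ is a derivation for all elements $x,y$ and all choices $T_x\in\{L_x,R_x\}$, $T_y\in\{L_y,R_y\}$ of left or right multiplication operators. For $\alpha\in\mathbb F$ let $\mathbf B_{6,1}^{\alpha}$ be the anticommutative algebra with basis $e_1,\dots,e_6$ and products $$[e_1,e_2]=e_4,\quad [e_1,e_3]=e_5,\quad [e_2,e_3]=\alpha e_6,\quad [e_4,e_5]=e_6,$$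 all products $[e_i,e_j]$ with $i<j$ not listed being zero. **Theorem.** Every $6$-dimensional nilpotent anticommutative $\mathfrak{CD}$-algebra over $\mathbb F$ is a Malcev algebra or is isomorphic to $\mathbf B_{6,1}^{\alpha}$ for some $\alpha\in\mathbb F$. Conversely, every $6$-dimensional nilpotent Malcev algebra over $\mathbb F$ is a $\mathfrak{CD}$-algebra. -/

import Mathlib

/-!
Algebras here are nonassociative algebras over a field: `[NonUnitalNonAssocRing A] [Module F A]`
with a bilinear product (`[IsScalarTower F A A] [SMulCommClass F A A]`). The product `x * y` plays
the role of the bracket `[x, y]`.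
-/

/-- The product is anticommutative. -/
def IsAnticommutative (A : Type*) [NonUnitalNonAssocRing A] : Prop :=
  ∀ x y : A, x * y = -(y * x)

/-- The Jacobian `J(x, y, z) = [[x, y], z] + [[y, z], x] + [[z, x], y]`. -/
def jacobian {A : Type*} [NonUnitalNonAssocRing A] (x y z : A) : A :=
  (x * y) * z + (y * z) * x + (z * x) * y

/-- Malcev algebras: anticommutative, with `J(x, y, [x, z]) = [J(x, y, z), x]`. -/
structure IsMalcevAlgebra (A : Type*) [NonUnitalNonAssocRing A] : Prop where
  anticommutative : IsAnticommutative A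
  malcev : ∀ x y z : A, jacobian x y (x * z) = jacobian x y z * x

section Bilinear

variable (F : Type*) [Field F] (A : Type*) [NonUnitalNonAssocRing A] [Module F A]
  [IsScalarTower F A A] [SMulCommClass F A A]

/-- The powers of an algebra: `A¹ = A` and
`Aᵐ⁺¹ = [A¹, Aᵐ] + [A², Aᵐ⁻¹] + ⋯ + [Aᵐ, A¹]`, where `[U, V]` is the span of the products
`u * v` with `u ∈ U`, `v ∈ V`. (The value at `0` is a convention and is not used.) -/
def algebraPower : ℕ → Submodule F A
  | 0 => ⊤
  | 1 => ⊤
  | m + 2 => ⨆ i : Fin (m + 1),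
      Submodule.map₂ (LinearMap.mul F A) (algebraPower (i + 1)) (algebraPower (m + 1 - i))

/-- The algebra is nilpotent: `Aⁿ = 0` for some `n ≥ 1`. -/
def IsNilpotentAlgebra : Prop :=
  ∃ n : ℕ, 1 ≤ n ∧ algebraPower F A n = ⊥

variable {F A} in
/-- The linear map `D` is a derivation of the algebra. -/
def IsDerivation (D : A →ₗ[F] A) : Prop :=
  ∀ x y : A, D (x * y) = D x * y + x * D y

variable {A} in
/-- `T` is one of the two multiplication operators `L_z : x ↦ z * x`, `R_z : x ↦ x * z`. -/
def IsMultiplicationOperator (z : A) (T : A →ₗ[F] A) : Prop :=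
  T = LinearMap.mulLeft F z ∨ T = LinearMap.mulRight F z

/-- CD-algebras: every commutator of two multiplication operators is a derivation. -/
def IsCDAlgebra : Prop :=
  ∀ (x y : A) (S T : A →ₗ[F] A), IsMultiplicationOperator F x S →
    IsMultiplicationOperator F y T → IsDerivation (S ∘ₗ T - T ∘ₗ S)

/-- Two algebras over `F` are isomorphic: there is a multiplicative linear equivalence. -/
def AlgebrasIsomorphic (B : Type*) [NonUnitalNonAssocRing B] [Module F B] : Prop :=
  ∃ e : A ≃ₗ[F] B, ∀ x y : A, e (x * y) = e x * e y

end Bilinear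

/-- The underlying space `F⁶` of the algebra `B_{6,1}^α`, with standard basis
`e₁, …, e₆` (indexed by `0, …, 5`). -/
def B61 {F : Type*} [Field F] (_α : F) : Type _ := Fin 6 → F

namespace B61

variable {F : Type*} [Field F] (α : F)

instance : AddCommGroup (B61 α) := inferInstanceAs (AddCommGroup (Fin 6 → F))

instance : Module F (B61 α) := inferInstanceAs (Module F (Fin 6 → F))

/-- The product of `B_{6,1}^α` in coordinates: the anticommutative bilinear product with
`[e₁, e₂] = e₄`, `[e₁, e₃] = e₅`, `[e₂, e₃] = α e₆`, `[e₄, e₅] = e₆`, all other products of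
basis vectors `eᵢ, eⱼ` with `i < j` being zero. -/
def product (x y : Fin 6 → F) : Fin 6 → F :=
  ![0, 0, 0,
    x 0 * y 1 - x 1 * y 0,
    x 0 * y 2 - x 2 * y 0,
    α * (x 1 * y 2 - x 2 * y 1) + (x 3 * y 4 - x 4 * y 3)]

instance : NonUnitalNonAssocRing (B61 α) where
  mul := product α
  left_distrib x y z := by
    change product α x (fun i => y i + z i) = fun i => product α x y i + product α x z i
    funext i; fin_cases i <;> simp [product] <;> ring
  right_distrib x y z := by
    change product α (fun i => x i + y i) z = fun i => product α x z i + product α y z i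
    funext i; fin_cases i <;> simp [product] <;> ring
  zero_mul x := by
    change product α (fun _ => 0) x = fun _ => 0
    funext i; fin_cases i <;> simp [product]
  mul_zero x := by
    change product α x (fun _ => 0) = fun _ => 0
    funext i; fin_cases i <;> simp [product]

instance : IsScalarTower F (B61 α) (B61 α) where
  smul_assoc c x y := by
    change product α (fun i => c * x i) y = fun i => c * product α x y i
    funext i; fin_cases i <;> simp [product] <;> ring

instance : SMulCommClass F (B61 α) (B61 α) where
  smul_comm c x y := by
    change (fun i => c * product α x y i) = product α x (fun i => c * y i)
    funext i; fin_cases i <;> simp [product] <;> ring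

end B61

/-! Write L_n for `lowerCentral F A n` (so L_0 = A, L_1 = AA) and J for the Jacobian. In an
anticommutative algebra [L_x, L_y] = L_{xy} - J(x, y, ·), and L_{xy} is a derivation exactly when
J(xy, ·, ·) = 0. Hence, if J(L_1, A, A) = 0, the CD condition and the Malcev condition are both
statements about the products J(x, y, z)w. CD makes these symmetric in z and w; since J is
alternating and 2 is invertible, they vanish, and Malcev follows (`IsMalcevAlgebra.of_isCDAlgebra`).
Conversely, J(L_1, A, A) = 0 and J(A, A, A)A = 0 give CD (`IsCDAlgebra.of_jacobian`).

It remains to obtain these vanishing statements from either identity. Nilpotency makes the L_n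
strictly decreasing until they reach 0, so in dimension 6 few dimension sequences occur.

If L_3 = 0 and L_1 L_1 = 0, everything is immediate. If L_3 = 0 and L_1 L_1 ≠ 0, the dimensions are
6, 3, 1, and good generators give the table of B_{6,1}^α (`algebrasIsomorphic_B61_of_mul_mem`); a
Malcev algebra cannot be of this kind, since its identity forces (xy)(xz) = 0.

If L_3 ≠ 0, then dim L_1 is 3 or 4. Dimension 3 means 6, 3, 2, 1, 0 with three generators
(`IsCDAlgebra.jacobian_eq_zero_of_three`, `IsMalcevAlgebra.jacobian_eq_zero_of_three`). Dimension 4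
means two generators and class four or five, and then J vanishes identically: everything is
generated by a, b, u = ab and, in class five, one element v spanning L_2 modulo L_3, and the
identities kill J on these. -/

/-! ### The lower central series and its strict descent. -/

section LowerCentral

variable (F : Type*) [Field F] (A : Type*) [NonUnitalNonAssocRing A] [Module F A]
  [IsScalarTower F A A] [SMulCommClass F A A]

/-- The lower central series `A, A A, A (A A), …`. -/
def lowerCentral : ℕ → Submodule F A
  | 0 => ⊤
  | n + 1 => Submodule.map₂ (LinearMap.mul F A) ⊤ (lowerCentral n)

variable {F A}

theorem mul_mem_lowerCentral {n : ℕ} (x : A) {y : A} (hy : y ∈ lowerCentral F A n) :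
    x * y ∈ lowerCentral F A (n + 1) :=
  Submodule.apply_mem_map₂ (LinearMap.mul F A) (Submodule.mem_top (x := x)) hy

theorem IsAnticommutative.mul_mem_lowerCentral (h : IsAnticommutative A) {n : ℕ} {x : A} (y : A)
    (hx : x ∈ lowerCentral F A n) : x * y ∈ lowerCentral F A (n + 1) := by
  rw [h x y]
  exact neg_mem (_root_.mul_mem_lowerCentral y hx)

theorem mul_mem_lowerCentral_one (x y : A) : x * y ∈ lowerCentral F A 1 :=
  mul_mem_lowerCentral (n := 0) x (Submodule.mem_top (x := y))

theorem lowerCentral_succ_le (n : ℕ) : lowerCentral F A (n + 1) ≤ lowerCentral F A n := by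
  induction n with
  | zero => exact le_top
  | succ n ih => exact Submodule.map₂_le_map₂_right ih

theorem lowerCentral_antitone : Antitone (lowerCentral F A) :=
  antitone_nat_of_succ_le lowerCentral_succ_le

/-- The summand [A^1, A^m] alone gives the inclusion. The shift arises because the series starts at
index 0 and the powers at 1. -/
theorem lowerCentral_le_algebraPower (n : ℕ) : lowerCentral F A n ≤ algebraPower F A (n + 1) := by
  induction n with
  | zero => simp [lowerCentral, algebraPower]
  | succ n ih =>
    rw [algebraPower]
    refine le_trans ?_ (le_iSup _ (0 : Fin (n + 1)))
    have h1 : algebraPower F A ((0 : Fin (n + 1)) + 1) = ⊤ := by simp [algebraPower]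
    have h2 : n + 1 - ((0 : Fin (n + 1)) : ℕ) = n + 1 := by simp
    rw [h1, h2]
    exact Submodule.map₂_le_map₂_right ih

/-- A series that repeats once is constant from there on, while nilpotency forces it to reach 0. -/
theorem lowerCentral_succ_lt (hnil : IsNilpotentAlgebra F A) {n : ℕ}
    (hn : lowerCentral F A n ≠ ⊥) : lowerCentral F A (n + 1) < lowerCentral F A n := by
  refine lt_of_le_of_ne (lowerCentral_succ_le n) fun heq => hn ?_
  obtain ⟨m, hm, hbot⟩ := hnil
  have hconst : ∀ k, lowerCentral F A (n + k) = lowerCentral F A n := by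
    intro k
    induction k with
    | zero => rfl
    | succ k ih =>
      rw [← add_assoc, lowerCentral, ih]
      exact heq
  have hle : lowerCentral F A n ≤ algebraPower F A m := by
    obtain ⟨j, rfl⟩ := Nat.exists_eq_add_of_le' hm
    calc lowerCentral F A n = lowerCentral F A (n + j) := (hconst j).symm
      _ ≤ lowerCentral F A j := lowerCentral_antitone (Nat.le_add_left j n)
      _ ≤ _ := lowerCentral_le_algebraPower j
  exact le_bot_iff.1 (hle.trans hbot.le)

theorem mul_eq_zero_of_lowerCentral {n : ℕ} (hn : lowerCentral F A (n + 1) = ⊥) (x : A) {y : A}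
    (hy : y ∈ lowerCentral F A n) : x * y = 0 := by
  have := mul_mem_lowerCentral x hy
  rwa [hn, Submodule.mem_bot] at this

theorem IsAnticommutative.mul_eq_zero_of_lowerCentral (h : IsAnticommutative A) {n : ℕ}
    (hn : lowerCentral F A (n + 1) = ⊥) {x : A} (y : A) (hx : x ∈ lowerCentral F A n) :
    x * y = 0 := by
  rw [h x y, _root_.mul_eq_zero_of_lowerCentral hn y hx, neg_zero]

/-- Products of elements of two sums of subspaces lie in `K` as soon as the products of generators
do. -/
theorem mul_mem_of_le_span_sup {s t : Set A} {U V X Y K : Submodule F A}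
    (hX : X ≤ Submodule.span F s ⊔ U) (hY : Y ≤ Submodule.span F t ⊔ V)
    (hst : ∀ x ∈ s, ∀ y ∈ t, x * y ∈ K) (hsV : ∀ x ∈ s, ∀ y ∈ V, x * y ∈ K)
    (hUt : ∀ x ∈ U, ∀ y ∈ t, x * y ∈ K) (hUV : ∀ x ∈ U, ∀ y ∈ V, x * y ∈ K) {x y : A}
    (hx : x ∈ X) (hy : y ∈ Y) : x * y ∈ K := by
  have key : Submodule.map₂ (LinearMap.mul F A) (Submodule.span F (s ∪ U))
      (Submodule.span F (t ∪ V)) ≤ K := by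
    rw [Submodule.map₂_span_span, Submodule.span_le]
    rintro _ ⟨x, hx | hx, y, hy | hy, rfl⟩
    exacts [hst x hx y hy, hsV x hx y hy, hUt x hx y hy, hUV x hx y hy]
  simp only [Submodule.span_union, Submodule.span_eq] at key
  exact key (Submodule.apply_mem_map₂ (LinearMap.mul F A) (hX hx) (hY hy))

theorem lowerCentral_succ_le_of {n : ℕ} {K : Submodule F A}
    (h : ∀ x : A, ∀ y ∈ lowerCentral F A n, x * y ∈ K) : lowerCentral F A (n + 1) ≤ K :=
  Submodule.map₂_le.2 fun x _ y hy => h x y hy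

end LowerCentral

/-! ### Alternation and linearity of the Jacobian. -/

section Jacobian

section

variable {A : Type*} [NonUnitalNonAssocRing A]

theorem jacobian_rotate (x y z : A) : jacobian x y z = jacobian y z x := by
  simp only [jacobian]; abel

theorem IsAnticommutative.jacobian_swap (h : IsAnticommutative A) (x y z : A) :
    jacobian x y z = -jacobian y x z := by
  simp only [jacobian, h x y, h y z, h z x, neg_mul]; abel

theorem IsAnticommutative.jacobian_swap_right (h : IsAnticommutative A) (x y z : A) :
    jacobian x y z = -jacobian x z y := by
  rw [jacobian_rotate, jacobian_rotate, h.jacobian_swap]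

variable {F : Type*} [Field F] [Module F A]

theorem IsAnticommutative.mul_self (h : IsAnticommutative A) (h2 : (2 : F) ≠ 0) (x : A) :
    x * x = 0 := by
  have h1 : (2 : F) • (x * x) = 0 := by
    rw [two_smul]; nth_rewrite 1 [h x x]; simp
  exact (smul_eq_zero.1 h1).resolve_left h2

theorem eq_zero_of_eq_neg (h2 : (2 : F) ≠ 0) {x : A} (hx : x = -x) : x = 0 := by
  have h1 : (2 : F) • x = 0 := by
    rw [two_smul]; nth_rewrite 1 [hx]; simp
  exact (smul_eq_zero.1 h1).resolve_left h2

theorem IsAnticommutative.jacobian_self (h : IsAnticommutative A) (h2 : (2 : F) ≠ 0) (x y : A) :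
    jacobian x x y = 0 :=
  eq_zero_of_eq_neg h2 (h.jacobian_swap x x y)

theorem IsAnticommutative.jacobian_self_right (h : IsAnticommutative A) (h2 : (2 : F) ≠ 0)
    (x y : A) : jacobian x y y = 0 := by
  rw [jacobian_rotate]; rw [jacobian_rotate, jacobian_rotate]
  exact eq_zero_of_eq_neg h2 (h.jacobian_swap_right x y y)

theorem IsAnticommutative.jacobian_self_mid (h : IsAnticommutative A) (h2 : (2 : F) ≠ 0)
    (x y : A) : jacobian x y x = 0 := by
  rw [jacobian_rotate]
  exact h.jacobian_self_right h2 y x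

end

variable {F : Type*} [Field F] {A : Type*} [NonUnitalNonAssocRing A] [Module F A]
  [IsScalarTower F A A] [SMulCommClass F A A]

theorem jacobian_add (x y z w : A) : jacobian x y (z + w) = jacobian x y z + jacobian x y w := by
  simp only [jacobian, mul_add, add_mul]; abel

theorem jacobian_neg (x y z : A) : jacobian x y (-z) = -jacobian x y z := by
  simp only [jacobian, mul_neg, neg_mul]; abel

theorem jacobian_smul (c : F) (x y z : A) : jacobian x y (c • z) = c • jacobian x y z := by
  simp only [jacobian, mul_smul_comm, smul_mul_assoc, smul_add]

theorem jacobian_zero (x y : A) : jacobian x y 0 = 0 := by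
  simp [jacobian]

variable (F) in
/-- The kernel of `z ↦ J(x, y, z)`. -/
def jacobianKer (x y : A) : Submodule F A where
  carrier := {z | jacobian x y z = 0}
  add_mem' {z w} hz hw := by
    change jacobian x y (z + w) = 0
    rw [jacobian_add, hz, hw, add_zero]
  zero_mem' := jacobian_zero x y
  smul_mem' c z hz := by
    change jacobian x y (c • z) = 0
    rw [jacobian_smul, hz, smul_zero]

/-- Linearity is set up in the last argument only; the other arguments are reached by rotating. -/
theorem jacobian_eq_zero_of_le_span_sup {s : Set A} {U X : Submodule F A}
    (hX : X ≤ Submodule.span F s ⊔ U) {x y : A} (hs : ∀ z ∈ s, jacobian x y z = 0)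
    (hU : ∀ z ∈ U, jacobian x y z = 0) {z : A} (hz : z ∈ X) : jacobian x y z = 0 := by
  have : Submodule.span F s ⊔ U ≤ jacobianKer F x y := sup_le (Submodule.span_le.2 hs) hU
  exact this (hX hz)

theorem IsAnticommutative.jacobian_eq_zero_of_central (h : IsAnticommutative A) {n : ℕ}
    (hn : lowerCentral F A (n + 1) = ⊥) {x y z : A} (hxy : x * y ∈ lowerCentral F A n)
    (hyz : y * z ∈ lowerCentral F A n) (hzx : z * x ∈ lowerCentral F A n) :
    jacobian x y z = 0 := by
  simp only [jacobian, h.mul_eq_zero_of_lowerCentral hn _ hxy,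
    h.mul_eq_zero_of_lowerCentral hn _ hyz, h.mul_eq_zero_of_lowerCentral hn _ hzx, add_zero]

/-- A central argument kills the Jacobian. -/
theorem IsAnticommutative.jacobian_central (h : IsAnticommutative A) {n : ℕ}
    (hn : lowerCentral F A (n + 1) = ⊥) (x y : A) {z : A} (hz : z ∈ lowerCentral F A n) :
    jacobian x y z = 0 := by
  have h1 : ∀ w, w * z = 0 := fun w => _root_.mul_eq_zero_of_lowerCentral hn w hz
  have h2 : ∀ w, z * w = 0 := fun w => h.mul_eq_zero_of_lowerCentral hn w hz
  simp only [jacobian, h1, h2, add_zero, zero_mul]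

end Jacobian

/-! ### The CD identity in terms of the Jacobian. -/

section CDIdentities

variable {F : Type*} [Field F] {A : Type*} [NonUnitalNonAssocRing A] [Module F A]
  [IsScalarTower F A A] [SMulCommClass F A A]

theorem IsCDAlgebra.left_identity (hcd : IsCDAlgebra F A) (x y z w : A) :
    x * (y * (z * w)) - y * (x * (z * w)) =
      (x * (y * z) - y * (x * z)) * w + z * (x * (y * w) - y * (x * w)) := by
  simpa using hcd x y _ _ (Or.inl rfl) (Or.inl rfl) z w

/-- The commutator of left multiplications in terms of the Jacobian. -/
theorem IsAnticommutative.commutator_eq (h : IsAnticommutative A) (x y z : A) :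
    x * (y * z) - y * (x * z) = (x * y) * z - jacobian x y z := by
  rw [jacobian, h (y * z) x, h z x, neg_mul, h (x * z) y]; abel

/-- By `h1`, L_{xy} is a derivation and J(x, y, ·) kills products; by `h3`, J(x, y, ·) is then
itself a derivation. Right multiplications are negatives of left ones, so only signs change. -/
theorem IsCDAlgebra.of_jacobian (h : IsAnticommutative A)
    (h1 : ∀ u ∈ lowerCentral F A 1, ∀ x y, jacobian u x y = 0)
    (h3 : ∀ x y z w : A, jacobian x y z * w = 0) : IsCDAlgebra F A := by
  have key : ∀ x y z w : A, x * (y * (z * w)) - y * (x * (z * w)) =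
      (x * (y * z) - y * (x * z)) * w + z * (x * (y * w) - y * (x * w)) := by
    intro x y z w
    simp only [h.commutator_eq]
    have e1 : jacobian x y (z * w) = 0 := by
      rw [← jacobian_rotate]; exact h1 _ (mul_mem_lowerCentral_one z w) x y
    have e2 : jacobian (x * y) z w = 0 := h1 _ (mul_mem_lowerCentral_one x y) z w
    have e3 : z * jacobian x y w = 0 := by rw [h, h3, neg_zero]
    rw [jacobian, h (z * w), h w (x * y), neg_mul, h ((x * y) * w) z] at e2
    rw [e1, sub_mul, mul_sub, h3, e3]
    linear_combination (norm := abel) -e2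
  intro x y S T hS hT z w
  have hR : ∀ x : A, LinearMap.mulRight F x = -LinearMap.mulLeft F x := by
    intro x; ext y; simpa using h y x
  have := key x y z w
  rcases hS with rfl | rfl <;> rcases hT with rfl | rfl <;> simp [hR, this]
  all_goals
    linear_combination (norm :=
      (simp only [add_mul, mul_add, sub_mul, mul_sub, neg_mul, mul_neg]; abel)) -this

/-- The expression J(x, y, z)w is symmetric under z ↔ w and antisymmetric under y ↔ z. Alternating
the two swaps three times each exchanges y and z in two ways with opposite signs, so it is zero. -/
theorem IsMalcevAlgebra.of_isCDAlgebra (h : IsAnticommutative A) (h2 : (2 : F) ≠ 0)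
    (hcd : IsCDAlgebra F A) (h1 : ∀ u ∈ lowerCentral F A 1, ∀ x y, jacobian u x y = 0) :
    IsMalcevAlgebra A := by
  have h1' : ∀ x y z w : A, jacobian x y (z * w) = 0 := fun x y z w => by
    rw [← jacobian_rotate]; exact h1 _ (mul_mem_lowerCentral_one (F := F) z w) x y
  have hsymm : ∀ x y z w : A, jacobian x y z * w = jacobian x y w * z := by
    intro x y z w
    have e1 := hcd.left_identity x y z w
    simp only [h.commutator_eq, h1'] at e1
    have e2 : jacobian (x * y) z w = 0 := h1 _ (mul_mem_lowerCentral_one x y) z w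
    rw [jacobian, h (z * w), h w (x * y), neg_mul, h ((x * y) * w) z] at e2
    rw [sub_mul, mul_sub, h z (jacobian x y w)] at e1
    linear_combination (norm := abel) e1 + e2
  have hzero : ∀ x y z w : A, jacobian x y z * w = 0 := by
    intro x y z w
    apply eq_zero_of_eq_neg h2
    calc jacobian x y z * w = jacobian x y w * z := hsymm _ _ _ _
      _ = -(jacobian x w y * z) := by rw [h.jacobian_swap_right, neg_mul]
      _ = -(jacobian x w z * y) := by rw [hsymm]
      _ = jacobian x z w * y := by rw [h.jacobian_swap_right, neg_mul, neg_neg]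
      _ = jacobian x z y * w := hsymm _ _ _ _
      _ = -(jacobian x y z * w) := by rw [h.jacobian_swap_right, neg_mul]
  exact ⟨h, fun x y z => by rw [h1', hzero]⟩

theorem IsCDAlgebra.jacobian_mul_self (hcd : IsCDAlgebra F A) (h : IsAnticommutative A)
    (h2 : (2 : F) ≠ 0) (x y : A) : jacobian x y (x * y) = 0 := by
  have e := hcd.left_identity x y x y
  simp only [h.mul_self h2, mul_zero, sub_zero, zero_sub] at e
  apply eq_zero_of_eq_neg h2
  rw [jacobian, h.mul_self h2, h (y * (x * y)) x, h (x * y) x, neg_mul, h (x * (x * y)) y]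
  rw [h y x, mul_neg, neg_mul, mul_neg, h (x * (x * y)) y] at e
  linear_combination (norm := abel) -e

/-- This is the CD counterpart of the Malcev identity, obtained by applying [L_x, L_y] to xz. -/
theorem IsCDAlgebra.jacobian_mul_left (hcd : IsCDAlgebra F A) (h : IsAnticommutative A)
    (h2 : (2 : F) ≠ 0) (x y z : A) :
    jacobian x y (x * z) = x * jacobian x y z - jacobian (x * y) x z := by
  have e := hcd.left_identity x y x z
  simp only [h.commutator_eq] at e
  rw [h.jacobian_self_mid h2, sub_zero, mul_sub] at e
  have e' : jacobian (x * y) x z = ((x * y) * x) * z + (x * z) * (x * y) + (z * (x * y)) * x := rfl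
  rw [e', h (x * z), h z (x * y), neg_mul, h ((x * y) * z) x]
  linear_combination (norm := abel) -e

theorem IsCDAlgebra.jacobian_mul_right (hcd : IsCDAlgebra F A) (h : IsAnticommutative A)
    (h2 : (2 : F) ≠ 0) (x y z : A) :
    jacobian x y (y * z) = y * jacobian x y z - jacobian (x * y) y z := by
  have e := hcd.left_identity x y y z
  simp only [h.commutator_eq] at e
  rw [h.jacobian_self_right h2, sub_zero, mul_sub] at e
  have e' : jacobian (x * y) y z = ((x * y) * y) * z + (y * z) * (x * y) + (z * (x * y)) * y := rfl
  rw [e', h (y * z), h z (x * y), neg_mul, h ((x * y) * z) y]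
  linear_combination (norm := abel) -e

end CDIdentities

/-! ### Algebras with two generators. -/

section TwoGenerators

variable {F : Type*} [Field F] {A : Type*} [NonUnitalNonAssocRing A] [Module F A]
  [IsScalarTower F A A] [SMulCommClass F A A] {a b : A}

theorem lowerCentral_one_le_of_two (h : IsAnticommutative A) (h2 : (2 : F) ≠ 0)
    (hgen : ⊤ ≤ Submodule.span F {a, b} ⊔ lowerCentral F A 1) :
    lowerCentral F A 1 ≤ Submodule.span F {a * b} ⊔ lowerCentral F A 2 := by
  refine lowerCentral_succ_le_of fun x y _ => mul_mem_of_le_span_sup hgen hgen ?_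
    (fun x _ y hy => Submodule.mem_sup_right (mul_mem_lowerCentral x hy))
    (fun x hx y _ => Submodule.mem_sup_right (h.mul_mem_lowerCentral y hx))
    (fun x hx y _ => Submodule.mem_sup_right (h.mul_mem_lowerCentral y hx))
    (Submodule.mem_top (x := x)) (Submodule.mem_top (x := y))
  have hab : a * b ∈ Submodule.span F {a * b} ⊔ lowerCentral F A 2 :=
    Submodule.mem_sup_left (Submodule.mem_span_singleton_self _)
  have hba := neg_mem hab
  rw [← h b a] at hba
  rintro x (rfl | rfl) y (rfl | rfl)
  · rw [h.mul_self h2]; exact zero_mem _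
  · exact hab
  · exact hba
  · rw [h.mul_self h2]; exact zero_mem _

/-- When L_1 is a line modulo L_2, uu = 0 removes the only product that is not already in A L_2. -/
theorem mul_mem_lowerCentral_three (h : IsAnticommutative A) (h2 : (2 : F) ≠ 0) {u : A}
    (hu : lowerCentral F A 1 ≤ Submodule.span F {u} ⊔ lowerCentral F A 2) {x y : A}
    (hx : x ∈ lowerCentral F A 1) (hy : y ∈ lowerCentral F A 1) :
    x * y ∈ lowerCentral F A 3 := by
  refine mul_mem_of_le_span_sup hu hu ?_
    (fun x _ y hy => mul_mem_lowerCentral x hy)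
    (fun x hx y _ => h.mul_mem_lowerCentral y hx)
    (fun x hx y _ => h.mul_mem_lowerCentral y hx) hx hy
  rintro x rfl y rfl
  rw [h.mul_self h2]; exact zero_mem _

theorem lowerCentral_two_le (h : IsAnticommutative A) (h2 : (2 : F) ≠ 0) {s : Set A} {u : A}
    (hgen : ⊤ ≤ Submodule.span F s ⊔ lowerCentral F A 1) (hu1 : u ∈ lowerCentral F A 1)
    (hu : lowerCentral F A 1 ≤ Submodule.span F {u} ⊔ lowerCentral F A 2) :
    lowerCentral F A 2 ≤ Submodule.span F ((· * u) '' s) ⊔ lowerCentral F A 3 := by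
  refine lowerCentral_succ_le_of fun x y hy => mul_mem_of_le_span_sup hgen hu ?_
    (fun x _ y hy => Submodule.mem_sup_right (mul_mem_lowerCentral x hy))
    ?_
    (fun x _ y hy => Submodule.mem_sup_right (mul_mem_lowerCentral x hy))
    (Submodule.mem_top (x := x)) hy
  · rintro x hx y rfl
    exact Submodule.mem_sup_left (Submodule.subset_span ⟨x, hx, rfl⟩)
  · rintro x hx y rfl
    exact Submodule.mem_sup_right (mul_mem_lowerCentral_three h h2 hu hx hu1)

theorem lowerCentral_three_le {s t : Set A}
    (hgen : ⊤ ≤ Submodule.span F s ⊔ lowerCentral F A 1)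
    (ht : lowerCentral F A 2 ≤ Submodule.span F t ⊔ lowerCentral F A 3)
    (hmul : ∀ x ∈ lowerCentral F A 1, ∀ y ∈ t, x * y ∈ lowerCentral F A 4) :
    lowerCentral F A 3 ≤ Submodule.span F (Set.image2 (· * ·) s t) ⊔ lowerCentral F A 4 := by
  refine lowerCentral_succ_le_of fun x y hy => mul_mem_of_le_span_sup hgen ht ?_
    (fun x _ y hy => Submodule.mem_sup_right (mul_mem_lowerCentral x hy))
    (fun x hx y hy => Submodule.mem_sup_right (hmul x hx y hy))
    (fun x _ y hy => Submodule.mem_sup_right (mul_mem_lowerCentral x hy))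
    (Submodule.mem_top (x := x)) hy
  exact fun x hx y hy => Submodule.mem_sup_left (Submodule.subset_span ⟨x, hx, y, hy, rfl⟩)

theorem jacobian_eq_zero_of_two (h : IsAnticommutative A) (h2 : (2 : F) ≠ 0)
    (hgen : ⊤ ≤ Submodule.span F {a, b} ⊔ lowerCentral F A 1)
    (hab : ∀ z, jacobian a b z = 0)
    (h1 : ∀ u ∈ lowerCentral F A 1, ∀ x y, jacobian u x y = 0) (x y z : A) :
    jacobian x y z = 0 := by
  refine jacobian_eq_zero_of_le_span_sup hgen ?_ (fun z hz => ?_) (Submodule.mem_top (x := z))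
  · have ha : ∀ y, jacobian a x y = 0 := fun y => by
      refine jacobian_eq_zero_of_le_span_sup hgen ?_ (fun z hz => ?_) (Submodule.mem_top (x := y))
      · rintro y (rfl | rfl)
        · exact h.jacobian_self_mid h2 _ _
        · rw [h.jacobian_swap_right, hab, neg_zero]
      · rw [← jacobian_rotate, h1 z hz]
    have hb : ∀ y, jacobian b x y = 0 := fun y => by
      refine jacobian_eq_zero_of_le_span_sup hgen ?_ (fun z hz => ?_) (Submodule.mem_top (x := y))
      · rintro y (rfl | rfl)
        · rw [← jacobian_rotate, hab]
        · exact h.jacobian_self_mid h2 _ _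
      · rw [← jacobian_rotate, h1 z hz]
    rintro z (rfl | rfl)
    · rw [← jacobian_rotate, ha]
    · rw [← jacobian_rotate, hb]
  · rw [← jacobian_rotate, h1 z hz]

/-- The algebra is spanned by a, b, u = ab and L_2. Of three arguments, two lie among a, b, u or two
lie in L_2, and the hypotheses cover each such pair. -/
theorem jacobian_eq_zero_of_two_of_lowerCentral_two (h : IsAnticommutative A)
    (h2 : (2 : F) ≠ 0) (hgen : ⊤ ≤ Submodule.span F {a, b} ⊔ lowerCentral F A 1)
    (hab : ∀ z, jacobian a b z = 0) (hau : ∀ z, jacobian a (a * b) z = 0)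
    (hbu : ∀ z, jacobian b (a * b) z = 0)
    (hL : ∀ v ∈ lowerCentral F A 2, ∀ w ∈ lowerCentral F A 2, ∀ x, jacobian v w x = 0)
    (x y z : A) : jacobian x y z = 0 := by
  have hu := lowerCentral_one_le_of_two h h2 hgen
  have huL : ∀ v ∈ lowerCentral F A 2, ∀ z, jacobian (a * b) v z = 0 := by
    intro v hv z
    refine jacobian_eq_zero_of_le_span_sup hgen ?_ (fun z hz => ?_) (Submodule.mem_top (x := z))
    · rintro z (rfl | rfl)
      · rw [← jacobian_rotate, hau]
      · rw [← jacobian_rotate, hbu]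
    · refine jacobian_eq_zero_of_le_span_sup hu ?_ (fun w hw => ?_) hz
      · rintro _ rfl
        exact h.jacobian_self_mid h2 _ _
      · rw [jacobian_rotate, hL v hv w hw]
  have hu0 : ∀ y z, jacobian (a * b) y z = 0 := by
    intro y z
    refine jacobian_eq_zero_of_le_span_sup hgen ?_ (fun z hz => ?_) (Submodule.mem_top (x := z))
    · rintro z (rfl | rfl)
      · rw [← jacobian_rotate, hau]
      · rw [← jacobian_rotate, hbu]
    · refine jacobian_eq_zero_of_le_span_sup hu ?_ (fun w hw => ?_) hz
      · rintro _ rfl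
        exact h.jacobian_self_mid h2 _ _
      · rw [h.jacobian_swap_right, huL w hw, neg_zero]
  have hv0 : ∀ v ∈ lowerCentral F A 2, ∀ y z, jacobian v y z = 0 := by
    intro v hv y z
    have hL1 : ∀ w ∈ lowerCentral F A 1, ∀ y, jacobian v y w = 0 := by
      intro w hw y
      refine jacobian_eq_zero_of_le_span_sup hu ?_ (fun w hw => ?_) hw
      · rintro _ rfl
        rw [← jacobian_rotate, hu0]
      · rw [h.jacobian_swap_right, hL v hv w hw, neg_zero]
    have ha : ∀ y, jacobian v a y = 0 := fun y => by
      refine jacobian_eq_zero_of_le_span_sup hgen ?_ (fun z hz => ?_) (Submodule.mem_top (x := y))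
      · rintro y (rfl | rfl)
        · exact h.jacobian_self_right h2 _ _
        · rw [jacobian_rotate, hab]
      · exact hL1 z hz _
    have hb : ∀ y, jacobian v b y = 0 := fun y => by
      refine jacobian_eq_zero_of_le_span_sup hgen ?_ (fun z hz => ?_) (Submodule.mem_top (x := y))
      · rintro y (rfl | rfl)
        · rw [h.jacobian_swap_right, jacobian_rotate, hab, neg_zero]
        · exact h.jacobian_self_right h2 _ _
      · exact hL1 z hz _
    refine jacobian_eq_zero_of_le_span_sup hgen ?_ (fun z hz => ?_) (Submodule.mem_top (x := z))
    · rintro z (rfl | rfl)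
      · rw [h.jacobian_swap_right, ha, neg_zero]
      · rw [h.jacobian_swap_right, hb, neg_zero]
    · exact hL1 z hz _
  refine jacobian_eq_zero_of_two h h2 hgen hab (fun v hv x y => ?_) x y z
  rw [jacobian_rotate]
  refine jacobian_eq_zero_of_le_span_sup hu ?_ (fun w hw => ?_) hv
  · rintro _ rfl
    rw [← jacobian_rotate, hu0]
  · rw [← jacobian_rotate, hv0 w hw]

/-- The final step for class at most four. -/
theorem jacobian_eq_zero_of_lowerCentral_four_eq_bot (h : IsAnticommutative A) (h2 : (2 : F) ≠ 0)
    (hgen : ⊤ ≤ Submodule.span F {a, b} ⊔ lowerCentral F A 1) (h4 : lowerCentral F A 4 = ⊥)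
    (hab : ∀ z, jacobian a b z = 0) (hau : ∀ z, jacobian a (a * b) z = 0)
    (hbu : ∀ z, jacobian b (a * b) z = 0) (x y z : A) : jacobian x y z = 0 :=
  jacobian_eq_zero_of_two_of_lowerCentral_two h h2 hgen hab hau hbu
    (fun v hv _ hw x => h.jacobian_eq_zero_of_central h4 (h.mul_mem_lowerCentral _ hv)
      (h.mul_mem_lowerCentral x hw) (mul_mem_lowerCentral x hv)) x y z

/-- The final step for class at most five. -/
theorem jacobian_eq_zero_of_lowerCentral_five_eq_bot (h : IsAnticommutative A) (h2 : (2 : F) ≠ 0)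
    (hgen : ⊤ ≤ Submodule.span F {a, b} ⊔ lowerCentral F A 1) (h5 : lowerCentral F A 5 = ⊥)
    {v : A} (hvL : v ∈ lowerCentral F A 2)
    (hv : lowerCentral F A 2 ≤ Submodule.span F {v} ⊔ lowerCentral F A 3)
    (h14 : ∀ x ∈ lowerCentral F A 1, x * v ∈ lowerCentral F A 4)
    (hab : ∀ z, jacobian a b z = 0) (hau : ∀ z, jacobian a (a * b) z = 0)
    (hbu : ∀ z, jacobian b (a * b) z = 0)
    (hav : ∀ w ∈ lowerCentral F A 3, jacobian a v w = 0)
    (hbv : ∀ w ∈ lowerCentral F A 3, jacobian b v w = 0) (x y z : A) : jacobian x y z = 0 := by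
  have hw0 : ∀ w ∈ lowerCentral F A 3, ∀ v' ∈ lowerCentral F A 2, ∀ x, jacobian w x v' = 0 := by
    intro w hw v' hv' x
    refine jacobian_eq_zero_of_le_span_sup hv ?_ (fun w' hw' => ?_) hv'
    · rintro _ rfl
      rw [← jacobian_rotate]
      refine jacobian_eq_zero_of_le_span_sup hgen ?_ (fun z hz => ?_) (Submodule.mem_top (x := x))
      · rintro z (rfl | rfl)
        · rw [← jacobian_rotate, hav w hw]
        · rw [← jacobian_rotate, hbv w hw]
      -- All three pairwise products lie in the central term L_4. For the product of z and v the
      -- filtration alone gives only L_3; `h14` supplies the missing step.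
      · exact h.jacobian_eq_zero_of_central h5 (mul_mem_lowerCentral _ hw)
          (h.mul_mem_lowerCentral _ hw) (h14 z hz)
    · exact h.jacobian_eq_zero_of_central h5 (h.mul_mem_lowerCentral _ hw)
          (mul_mem_lowerCentral _ hw') (mul_mem_lowerCentral _ hw)
  refine jacobian_eq_zero_of_two_of_lowerCentral_two h h2 hgen hab hau hbu
    (fun v1 hv1 v2 hv2 x => ?_) x y z
  rw [← jacobian_rotate]
  refine jacobian_eq_zero_of_le_span_sup hv ?_ (fun w hw => ?_) hv2
  · rintro _ rfl
    rw [← jacobian_rotate]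
    refine jacobian_eq_zero_of_le_span_sup hv ?_ (fun w hw => ?_) hv1
    · rintro _ rfl
      exact h.jacobian_self_mid h2 _ _
    · rw [← jacobian_rotate, h.jacobian_swap_right, hw0 w hw _ hvL, neg_zero]
  · rw [← jacobian_rotate, hw0 w hw _ hv1]

/-- Expanding J(a, b, v) = 0 writes (ab)v through (bv)a and (va)b, which lie one step deeper than
expected. The rest of L_1 is spanned by v, with vv = 0, and L_3. -/
theorem mul_mem_lowerCentral_four_of_jacobian (h : IsAnticommutative A) (h2 : (2 : F) ≠ 0)
    {v : A} (hgen : ⊤ ≤ Submodule.span F {a, b} ⊔ lowerCentral F A 1)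
    (hv2 : v ∈ lowerCentral F A 2)
    (hv : lowerCentral F A 2 ≤ Submodule.span F {v} ⊔ lowerCentral F A 3)
    (hv0 : jacobian a b v = 0) {x : A} (hx : x ∈ lowerCentral F A 1) :
    x * v ∈ lowerCentral F A 4 := by
  have huv : (a * b) * v ∈ lowerCentral F A 4 := by
    have e : (a * b) * v = -((b * v) * a) - (v * a) * b := by
      rw [← sub_eq_zero, ← hv0, jacobian]; abel
    rw [e]
    exact sub_mem (neg_mem (h.mul_mem_lowerCentral _ (mul_mem_lowerCentral _ hv2)))
      (h.mul_mem_lowerCentral _ (h.mul_mem_lowerCentral _ hv2))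
  refine mul_mem_of_le_span_sup (lowerCentral_one_le_of_two h h2 hgen) hv ?_
    (fun x _ y hy => mul_mem_lowerCentral x hy) ?_
    (fun x _ y hy => mul_mem_lowerCentral x hy) hx hv2
  · rintro _ rfl _ rfl
    exact huv
  · rintro x hx _ rfl
    refine mul_mem_of_le_span_sup hv hv ?_ (fun x _ y hy => mul_mem_lowerCentral x hy)
      (fun x hx y _ => h.mul_mem_lowerCentral y hx)
      (fun x hx y _ => h.mul_mem_lowerCentral y hx) hx hv2
    rintro _ rfl _ rfl
    rw [h.mul_self h2]; exact zero_mem _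

/-- The algebra is spanned by a, b, ab, v, av, bv and the central term L_4. -/
theorem jacobian_eq_zero_of_generators (h : IsAnticommutative A) (h2 : (2 : F) ≠ 0)
    {v : A} (hgen : ⊤ ≤ Submodule.span F {a, b} ⊔ lowerCentral F A 1)
    (hv2 : v ∈ lowerCentral F A 2)
    (hv : lowerCentral F A 2 ≤ Submodule.span F {v} ⊔ lowerCentral F A 3)
    (h5 : lowerCentral F A 5 = ⊥) (hu0 : jacobian a b (a * b) = 0) (hv0 : jacobian a b v = 0)
    (hav : jacobian a b (a * v) = 0) (hbv : jacobian a b (b * v) = 0) (z : A) :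
    jacobian a b z = 0 := by
  have hu := lowerCentral_one_le_of_two h h2 hgen
  have hw := lowerCentral_three_le hgen hv (by
    rintro x hx _ rfl; exact mul_mem_lowerCentral_four_of_jacobian h h2 hgen hv2 hv hv0 hx)
  refine jacobian_eq_zero_of_le_span_sup hgen ?_ (fun z hz => ?_) (Submodule.mem_top (x := z))
  · rintro z (rfl | rfl)
    · exact h.jacobian_self_mid h2 _ _
    · exact h.jacobian_self_right h2 _ _
  refine jacobian_eq_zero_of_le_span_sup hu ?_ (fun z hz => ?_) hz
  · rintro _ rfl
    exact hu0
  refine jacobian_eq_zero_of_le_span_sup hv ?_ (fun z hz => ?_) hz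
  · rintro _ rfl
    exact hv0
  refine jacobian_eq_zero_of_le_span_sup hw ?_ (fun w hw => h.jacobian_central h5 _ _ hw) hz
  rintro _ ⟨x, (rfl | rfl), _, rfl, rfl⟩
  · exact hav
  · exact hbv

end TwoGenerators

/-! ### Malcev algebras with two generators. -/

section MalcevTwoGenerators

variable {F : Type*} [Field F] {A : Type*} [NonUnitalNonAssocRing A] [Module F A]
  [IsScalarTower F A A] [SMulCommClass F A A] {a b : A}

theorem IsMalcevAlgebra.linearized (hM : IsMalcevAlgebra A) (x y z w : A) :
    jacobian x y (w * z) + jacobian w y (x * z) = jacobian x y z * w + jacobian w y z * x := by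
  have hadd : ∀ t, jacobian (x + w) y t = jacobian x y t + jacobian w y t := fun t => by
    rw [jacobian_rotate, jacobian_add, ← jacobian_rotate x, ← jacobian_rotate w]
  have e := hM.malcev (x + w) y z
  rw [hadd, hadd, add_mul, jacobian_add, jacobian_add, hM.malcev, hM.malcev, add_mul, mul_add,
    mul_add] at e
  linear_combination (norm := abel) e

theorem IsMalcevAlgebra.jacobian_mul_right (hM : IsMalcevAlgebra A) (x y z : A) :
    jacobian x y (y * z) = jacobian x y z * y := by
  rw [hM.anticommutative.jacobian_swap, hM.malcev, hM.anticommutative.jacobian_swap x y z, neg_mul]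

/-- The Malcev identity with the roles of its first two arguments exchanged. -/
theorem IsMalcevAlgebra.jacobian_mul_mid (hM : IsMalcevAlgebra A) {x y : A}
    (hxy : ∀ z, jacobian x y z = 0) (z : A) : jacobian x (x * y) z = 0 := by
  rw [hM.anticommutative.jacobian_swap_right, hM.malcev, hM.anticommutative.jacobian_swap_right,
    hxy, neg_zero, zero_mul, neg_zero]

theorem IsMalcevAlgebra.jacobian_mul_mid' (hM : IsMalcevAlgebra A) {x y : A}
    (hxy : ∀ z, jacobian x y z = 0) (z : A) : jacobian y (x * y) z = 0 := by
  rw [hM.anticommutative x y, hM.anticommutative.jacobian_swap_right, jacobian_neg, neg_neg,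
    hM.malcev, jacobian_rotate, jacobian_rotate, hxy, zero_mul]

theorem IsMalcevAlgebra.jacobian_eq_zero_of_lowerCentral_four (hM : IsMalcevAlgebra A)
    (h2 : (2 : F) ≠ 0) (hgen : ⊤ ≤ Submodule.span F {a, b} ⊔ lowerCentral F A 1)
    (h4 : lowerCentral F A 4 = ⊥) (x y z : A) : jacobian x y z = 0 := by
  have h := hM.anticommutative
  have hu := lowerCentral_one_le_of_two h h2 hgen
  have hv := lowerCentral_two_le h h2 hgen (mul_mem_lowerCentral_one a b) hu
  have hu0 : jacobian a b (a * b) = 0 := by rw [hM.malcev, h.jacobian_self_right h2, zero_mul]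
  have hab : ∀ z, jacobian a b z = 0 := fun z => by
    refine jacobian_eq_zero_of_le_span_sup hgen ?_ (fun z hz => ?_) (Submodule.mem_top (x := z))
    · rintro z (rfl | rfl)
      · exact h.jacobian_self_mid h2 _ _
      · exact h.jacobian_self_right h2 _ _
    refine jacobian_eq_zero_of_le_span_sup hu ?_ (fun w hw => ?_) hz
    · rintro _ rfl
      exact hu0
    refine jacobian_eq_zero_of_le_span_sup hv ?_ (fun w hw => h.jacobian_central h4 _ _ hw) hw
    rintro _ ⟨t, (rfl | rfl), rfl⟩
    · change jacobian t b (t * (t * b)) = 0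
      rw [hM.malcev, hu0, zero_mul]
    · change jacobian a t (t * (a * t)) = 0
      rw [hM.jacobian_mul_right, hu0, zero_mul]
  exact jacobian_eq_zero_of_lowerCentral_four_eq_bot h h2 hgen h4 hab (hM.jacobian_mul_mid hab)
    (hM.jacobian_mul_mid' hab) x y z

theorem IsMalcevAlgebra.jacobian_eq_zero_of_lowerCentral_five (hM : IsMalcevAlgebra A)
    (h2 : (2 : F) ≠ 0) (hgen : ⊤ ≤ Submodule.span F {a, b} ⊔ lowerCentral F A 1)
    (hv : lowerCentral F A 2 ≤ Submodule.span F {a * (a * b)} ⊔ lowerCentral F A 3)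
    (hbu : b * (a * b) ∈ lowerCentral F A 3)
    (h5 : lowerCentral F A 5 = ⊥) (x y z : A) : jacobian x y z = 0 := by
  have h := hM.anticommutative
  have hu := lowerCentral_one_le_of_two h h2 hgen
  have hv2 : a * (a * b) ∈ lowerCentral F A 2 :=
    mul_mem_lowerCentral _ (mul_mem_lowerCentral_one a b)
  have hu0 : jacobian a b (a * b) = 0 := by rw [hM.malcev, h.jacobian_self_right h2, zero_mul]
  have hv0 : jacobian a b (a * (a * b)) = 0 := by rw [hM.malcev, hu0, zero_mul]
  have hab := jacobian_eq_zero_of_generators h h2 hgen hv2 hv h5 hu0 hv0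
    (by rw [hM.malcev, hv0, zero_mul]) (by rw [hM.jacobian_mul_right, hv0, zero_mul])
  have hau := hM.jacobian_mul_mid hab
  have hbu' := hM.jacobian_mul_mid' hab
  refine jacobian_eq_zero_of_lowerCentral_five_eq_bot h h2 hgen h5 hv2 hv
    (fun x hx => mul_mem_lowerCentral_four_of_jacobian h h2 hgen hv2 hv hv0 hx) hab hau hbu'
    (fun w _ => hM.jacobian_mul_mid hau w) (fun w hw => ?_) x y z
  -- The only condition the direct identities leave open is J(b, v, w) = 0. Polarization trades
  -- a(ab) paired with b for b(ab) paired with a, and b(ab) lies in L_3.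
  have e := hM.linearized b w (a * b) a
  have e1 : jacobian a w (b * (a * b)) = 0 := by
    rw [← jacobian_rotate]
    exact h.jacobian_eq_zero_of_central h5 (h.mul_mem_lowerCentral _ hbu)
      (mul_mem_lowerCentral _ hw) (h.mul_mem_lowerCentral _ hw)
  rw [e1, h.jacobian_swap_right b, h.jacobian_swap_right a w, hau,
    h.jacobian_swap_right b w, hbu'] at e
  simpa using e

end MalcevTwoGenerators

/-! ### CD-algebras with two generators. -/

section CDTwoGenerators

variable {F : Type*} [Field F] {A : Type*} [NonUnitalNonAssocRing A] [Module F A]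
  [IsScalarTower F A A] [SMulCommClass F A A] {a b : A}

theorem IsCDAlgebra.jacobian_mul_mul_self (hcd : IsCDAlgebra F A) (h : IsAnticommutative A)
    (h2 : (2 : F) ≠ 0) (x y : A) : jacobian x y (x * (x * y)) = 0 := by
  rw [hcd.jacobian_mul_left h h2, hcd.jacobian_mul_self h h2, mul_zero,
    h.jacobian_self_mid h2, sub_zero]

theorem IsCDAlgebra.jacobian_mul_mul_self' (hcd : IsCDAlgebra F A) (h : IsAnticommutative A)
    (h2 : (2 : F) ≠ 0) (x y : A) : jacobian x y (y * (x * y)) = 0 := by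
  rw [hcd.jacobian_mul_right h h2, hcd.jacobian_mul_self h h2, mul_zero,
    h.jacobian_self_mid h2, sub_zero]

theorem IsCDAlgebra.jacobian_mul_mid (hcd : IsCDAlgebra F A) (h : IsAnticommutative A)
    (h2 : (2 : F) ≠ 0) {x y : A} (hxy : ∀ z, jacobian x y z = 0) (z : A) :
    jacobian x (x * y) z = 0 := by
  have e := hcd.jacobian_mul_left h h2 x y z
  rw [hxy, hxy, mul_zero, zero_sub, h.jacobian_swap, neg_neg] at e
  exact e.symm

theorem IsCDAlgebra.jacobian_mul_mid' (hcd : IsCDAlgebra F A) (h : IsAnticommutative A)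
    (h2 : (2 : F) ≠ 0) {x y : A} (hxy : ∀ z, jacobian x y z = 0) (z : A) :
    jacobian y (x * y) z = 0 := by
  have e := hcd.jacobian_mul_right h h2 x y z
  rw [hxy, hxy, mul_zero, zero_sub, h.jacobian_swap, neg_neg] at e
  exact e.symm

theorem IsCDAlgebra.jacobian_eq_zero_of_lowerCentral_four (hcd : IsCDAlgebra F A)
    (h : IsAnticommutative A) (h2 : (2 : F) ≠ 0)
    (hgen : ⊤ ≤ Submodule.span F {a, b} ⊔ lowerCentral F A 1)
    (h4 : lowerCentral F A 4 = ⊥) (x y z : A) : jacobian x y z = 0 := by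
  have hu := lowerCentral_one_le_of_two h h2 hgen
  have hv := lowerCentral_two_le h h2 hgen (mul_mem_lowerCentral_one a b) hu
  have hab : ∀ z, jacobian a b z = 0 := fun z => by
    refine jacobian_eq_zero_of_le_span_sup hgen ?_ (fun z hz => ?_) (Submodule.mem_top (x := z))
    · rintro z (rfl | rfl)
      · exact h.jacobian_self_mid h2 _ _
      · exact h.jacobian_self_right h2 _ _
    refine jacobian_eq_zero_of_le_span_sup hu ?_ (fun w hw => ?_) hz
    · rintro _ rfl
      exact hcd.jacobian_mul_self h h2 a b
    refine jacobian_eq_zero_of_le_span_sup hv ?_ (fun w hw => h.jacobian_central h4 _ _ hw) hw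
    rintro _ ⟨t, (rfl | rfl), rfl⟩
    · exact hcd.jacobian_mul_mul_self h h2 t b
    · exact hcd.jacobian_mul_mul_self' h h2 a t
  exact jacobian_eq_zero_of_lowerCentral_four_eq_bot h h2 hgen h4 hab
    (hcd.jacobian_mul_mid h h2 hab) (hcd.jacobian_mul_mid' h h2 hab) x y z

/-- Special cases of the CD identity, with all terms in the central L_4 discarded, show that u and v
annihilate av and bv. The Jacobians still needed then expand into vanishing products. -/
theorem IsCDAlgebra.jacobian_eq_zero_of_lowerCentral_five (hcd : IsCDAlgebra F A)
    (h : IsAnticommutative A) (h2 : (2 : F) ≠ 0)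
    (hgen : ⊤ ≤ Submodule.span F {a, b} ⊔ lowerCentral F A 1)
    (hv : lowerCentral F A 2 ≤ Submodule.span F {a * (a * b)} ⊔ lowerCentral F A 3)
    (hbu : b * (a * b) ∈ lowerCentral F A 3)
    (h33 : ∀ x ∈ lowerCentral F A 3, ∀ y ∈ lowerCentral F A 3, x * y = 0)
    (h5 : lowerCentral F A 5 = ⊥) (x y z : A) : jacobian x y z = 0 := by
  set u := a * b with hudef
  set v := a * u with hvdef
  have hu1 : u ∈ lowerCentral F A 1 := mul_mem_lowerCentral_one a b
  have hv2 : v ∈ lowerCentral F A 2 := mul_mem_lowerCentral _ hu1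
  have hv0 : jacobian a b v = 0 := hcd.jacobian_mul_mul_self h h2 a b
  have h14 : ∀ x ∈ lowerCentral F A 1, x * v ∈ lowerCentral F A 4 := fun x hx =>
    mul_mem_lowerCentral_four_of_jacobian h h2 hgen hv2 hv hv0 hx
  have hw := lowerCentral_three_le hgen hv (by rintro x hx _ rfl; exact h14 x hx)
  have c4 : ∀ {x : A} (y : A), x ∈ lowerCentral F A 4 → y * x = 0 :=
    fun y hx => mul_eq_zero_of_lowerCentral h5 y hx
  have c4' : ∀ {x : A} (y : A), x ∈ lowerCentral F A 4 → x * y = 0 :=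
    fun y hx => h.mul_eq_zero_of_lowerCentral h5 y hx
  have huv4 : u * v ∈ lowerCentral F A 4 := h14 u hu1
  have hvu4 : v * u ∈ lowerCentral F A 4 := by rw [h]; exact neg_mem huv4
  have hav3 : a * v ∈ lowerCentral F A 3 := mul_mem_lowerCentral _ hv2
  have hbv3 : b * v ∈ lowerCentral F A 3 := mul_mem_lowerCentral _ hv2
  have hself := fun x : A => h.mul_self h2 x
  -- `v` annihilates the third term
  have hva : v * (a * v) = 0 := by
    have e := hcd.left_identity a v a u
    rw [← hvdef, hself v, mul_zero, hself a, mul_zero, c4 a hvu4, sub_zero, sub_zero,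
      h v a, mul_neg, neg_mul, mul_zero, c4' u (mul_mem_lowerCentral _ hav3)] at e
    simpa using e
  have hvb : v * (b * v) = 0 := by
    have e := hcd.left_identity b v a u
    have e1 : v * (b * u) ∈ lowerCentral F A 4 := mul_mem_lowerCentral _ hbu
    have e2 : b * a = -u := h b a
    rw [← hvdef, hself v, mul_zero, h v a, mul_neg, e2, mul_neg, sub_mul, neg_mul, neg_mul,
      c4' u (mul_mem_lowerCentral _ hav3), c4' u hvu4, c4 b hvu4, mul_sub, mul_zero, c4 a e1] at e
    simpa using e
  have hv3 : ∀ w ∈ lowerCentral F A 3, v * w = 0 := fun w hw' => by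
    have : w ∈ LinearMap.ker (LinearMap.mulLeft F v) := by
      refine (hw.trans (sup_le (Submodule.span_le.2 ?_) fun w hw => ?_)) hw'
      · rintro _ ⟨x, (rfl | rfl), _, rfl, rfl⟩
        · exact hva
        · exact hvb
      · exact c4 v hw
    exact this
  -- The CD identity for a, u applied to au reduces to u(av) = -u(av), since uv is central.
  have hua : u * (a * v) = 0 := by
    have e := hcd.left_identity a u a u
    rw [← hvdef, hself u, mul_zero, hself a, mul_zero, c4 a huv4, h u a, ← hvdef] at e
    refine eq_zero_of_eq_neg h2 ?_
    simp only [mul_neg, zero_sub, sub_zero, neg_mul, c4 a huv4] at e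
    rw [h (a * v) u] at e
    linear_combination (norm := abel) -e
  have hub : u * (b * v) = 0 := by
    have e := hcd.left_identity b u a u
    have e1 : u * (b * u) ∈ lowerCentral F A 4 := mul_mem_lowerCentral _ hbu
    have e2 : b * a = -u := h b a
    rw [← hvdef, hself u, mul_zero, c4 b huv4, h u a, ← hvdef, e2] at e
    refine eq_zero_of_eq_neg h2 ?_
    simp only [mul_neg, zero_sub, sub_zero, neg_mul, c4 a e1, hself u, neg_zero] at e
    rw [h (b * v) u] at e
    linear_combination (norm := abel) -e
  have hab := jacobian_eq_zero_of_generators h h2 hgen hv2 hv h5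
    (hcd.jacobian_mul_self h h2 a b) hv0
    (by
      rw [hcd.jacobian_mul_left h h2, hv0, mul_zero, jacobian, ← hudef, h u a, ← hvdef, neg_mul,
        hself v, h (a * v) u, hua, c4' a hvu4]
      simp)
    (by
      rw [hcd.jacobian_mul_right h h2, hv0, mul_zero, jacobian, ← hudef, h u b, neg_mul,
        h (b * u) v, hv3 _ hbu, h (b * v) u, hub, c4' b hvu4]
      simp)
  refine jacobian_eq_zero_of_lowerCentral_five_eq_bot h h2 hgen h5 hv2 hv h14 hab
    (hcd.jacobian_mul_mid h h2 hab) (hcd.jacobian_mul_mid' h h2 hab) ?_ ?_ x y z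
  · intro w hw
    rw [jacobian, h33 _ hav3 _ hw, hv3 w hw, h (w * a) v,
      hv3 _ (lowerCentral_succ_le 3 (h.mul_mem_lowerCentral a hw))]
    simp
  · intro w hw
    rw [jacobian, h33 _ hbv3 _ hw, hv3 w hw, h (w * b) v,
      hv3 _ (lowerCentral_succ_le 3 (h.mul_mem_lowerCentral b hw))]
    simp

end CDTwoGenerators

/-! ### Algebras with three generators and dimensions 6, 3, 2, 1, 0. -/

section ThreeGenerators

variable {F : Type*} [Field F] {A : Type*} [NonUnitalNonAssocRing A] [Module F A]
  [IsScalarTower F A A] [SMulCommClass F A A] {a b c : A}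

theorem jacobian_mem_of_le_span_sup {s : Set A} {U X K : Submodule F A}
    (hX : X ≤ Submodule.span F s ⊔ U) {x y : A} (hs : ∀ z ∈ s, jacobian x y z ∈ K)
    (hU : ∀ z ∈ U, jacobian x y z ∈ K) {z : A} (hz : z ∈ X) : jacobian x y z ∈ K := by
  let f : A →ₗ[F] A :=
    { toFun := jacobian x y
      map_add' := jacobian_add x y
      map_smul' := fun c z => jacobian_smul c x y z }
  have : Submodule.span F s ⊔ U ≤ K.comap f := sup_le (Submodule.span_le.2 hs) hU
  exact this (hX hz)

/-- For K = L_3 with L_4 = 0 this makes every Jacobian central. -/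
theorem jacobian_mem_of_three (h : IsAnticommutative A) (h2 : (2 : F) ≠ 0) {K : Submodule F A}
    (hgen : ⊤ ≤ Submodule.span F {a, b, c} ⊔ lowerCentral F A 1) (habc : jacobian a b c ∈ K)
    (h1 : ∀ u ∈ lowerCentral F A 1, ∀ x y, jacobian u x y ∈ K) (x y z : A) :
    jacobian x y z ∈ K := by
  have base : ∀ x ∈ ({a, b, c} : Set A), ∀ y ∈ ({a, b, c} : Set A), ∀ z ∈ ({a, b, c} : Set A),
      jacobian x y z ∈ K := by
    have h231 : jacobian b c a ∈ K := by rwa [← jacobian_rotate]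
    have h312 : jacobian c a b ∈ K := by rwa [← jacobian_rotate]
    have h213 : jacobian b a c ∈ K := by rw [h.jacobian_swap]; exact neg_mem habc
    have h321 : jacobian c b a ∈ K := by rw [h.jacobian_swap]; exact neg_mem h231
    have h132 : jacobian a c b ∈ K := by rw [h.jacobian_swap]; exact neg_mem h312
    have d1 : ∀ x y : A, jacobian x x y ∈ K := fun x y => by
      rw [h.jacobian_self h2]; exact zero_mem _
    have d2 : ∀ x y : A, jacobian x y x ∈ K := fun x y => by
      rw [h.jacobian_self_mid h2]; exact zero_mem _
    have d3 : ∀ x y : A, jacobian x y y ∈ K := fun x y => by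
      rw [h.jacobian_self_right h2]; exact zero_mem _
    intro x hx y hy z hz
    simp only [Set.mem_insert_iff, Set.mem_singleton_iff] at hx hy hz
    rcases hx with hx | hx | hx <;> rcases hy with hy | hy | hy <;>
      rcases hz with hz | hz | hz <;> rw [hx, hy, hz] <;>
      first | assumption | exact d1 _ _ | exact d2 _ _ | exact d3 _ _
  refine jacobian_mem_of_le_span_sup hgen (fun z hz => ?_) (fun z hz => ?_)
    (Submodule.mem_top (x := z))
  · rw [← jacobian_rotate]
    refine jacobian_mem_of_le_span_sup hgen (fun y hy => ?_) (fun y hy => ?_)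
      (Submodule.mem_top (x := y))
    · rw [← jacobian_rotate]
      refine jacobian_mem_of_le_span_sup hgen (fun x hx => ?_) (fun x hx => ?_)
        (Submodule.mem_top (x := x))
      · exact base y hy z hz x hx
      · rw [← jacobian_rotate]; exact h1 x hx y z
    · rw [← jacobian_rotate]; exact h1 y hy z x
  · rw [← jacobian_rotate]; exact h1 z hz x y

/-- An argument v in L_2 is harmless: two of the three terms lie in L_4 = 0 and the third is a
product of L_1 with L_2. What remains is J(ab, ·, ·) on pairs of generators. -/
theorem jacobian_lowerCentral_one_eq_zero_of_three (h : IsAnticommutative A) (h2 : (2 : F) ≠ 0)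
    (hgen : ⊤ ≤ Submodule.span F {a, b, c} ⊔ lowerCentral F A 1)
    (hu : lowerCentral F A 1 ≤ Submodule.span F {a * b} ⊔ lowerCentral F A 2)
    (h4 : lowerCentral F A 4 = ⊥)
    (h22 : ∀ x ∈ lowerCentral F A 2, ∀ y ∈ lowerCentral F A 2, x * y = 0)
    (hu2 : ∀ v ∈ lowerCentral F A 2, (a * b) * v = 0) (hab : jacobian a b (a * b) = 0)
    (hac : jacobian a c (a * b) = 0) (hbc : jacobian b c (a * b) = 0) :
    ∀ w ∈ lowerCentral F A 1, ∀ x y, jacobian w x y = 0 := by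
  have c3 : ∀ {x : A} (y : A), x ∈ lowerCentral F A 3 → x * y = 0 :=
    fun y hx => h.mul_eq_zero_of_lowerCentral h4 y hx
  have hv : ∀ v ∈ lowerCentral F A 2, ∀ x y, jacobian v x y = 0 := by
    intro v hv x y
    have e : (x * y) * v = 0 := by
      -- An empty generating set lets the general span lemma accept the second factor as it is.
      refine mul_mem_of_le_span_sup (K := ⊥) hu (le_sup_right (a := Submodule.span F ∅)) ?_ ?_ ?_ ?_
        (mul_mem_lowerCentral_one x y) hv
      · simp
      · rintro _ rfl y hy; exact hu2 y hy
      · simp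
      · exact h22
    rw [jacobian, c3 y (h.mul_mem_lowerCentral x hv), c3 x (mul_mem_lowerCentral y hv), e]
    simp
  have hL1 : ∀ x, ∀ y ∈ lowerCentral F A 1, jacobian (a * b) x y = 0 := by
    intro x y hy
    refine jacobian_eq_zero_of_le_span_sup hu ?_ (fun w hw => ?_) hy
    · rintro _ rfl
      exact h.jacobian_self_mid h2 _ _
    · rw [← jacobian_rotate, hv w hw]
  have hswap : ∀ {x y z : A}, jacobian x y z = 0 → jacobian z y x = 0 := fun e => by
    rw [h.jacobian_swap, jacobian_rotate, jacobian_rotate, e, neg_zero]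
  have hrot : ∀ {x y z : A}, jacobian x y z = 0 → jacobian z x y = 0 := fun e => by
    rw [jacobian_rotate, e]
  have base : ∀ x ∈ ({a, b, c} : Set A), ∀ y ∈ ({a, b, c} : Set A),
      jacobian (a * b) x y = 0 := by
    have d3 : ∀ x y : A, jacobian x y y = 0 := fun x y => h.jacobian_self_right h2 x y
    intro x hx y hy
    simp only [Set.mem_insert_iff, Set.mem_singleton_iff] at hx hy
    rcases hx with hx | hx | hx <;> rcases hy with hy | hy | hy <;> rw [hx, hy] <;>
      first | exact d3 _ _ | exact hrot ‹_› | exact hswap ‹_›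
  intro w hw x y
  rw [jacobian_rotate]
  refine jacobian_eq_zero_of_le_span_sup hu ?_ (fun w hw => ?_) hw
  · rintro _ rfl
    rw [← jacobian_rotate]
    refine jacobian_eq_zero_of_le_span_sup hgen (fun y hy => ?_) (hL1 x)
      (Submodule.mem_top (x := y))
    rw [h.jacobian_swap_right, neg_eq_zero]
    exact jacobian_eq_zero_of_le_span_sup hgen (fun x hx => base y hy x hx) (hL1 y)
      (Submodule.mem_top (x := x))
  · rw [← jacobian_rotate, hv w hw]

theorem IsCDAlgebra.jacobian_eq_zero_of_three (hcd : IsCDAlgebra F A)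
    (h : IsAnticommutative A) (h2 : (2 : F) ≠ 0)
    (hgen : ⊤ ≤ Submodule.span F {a, b, c} ⊔ lowerCentral F A 1)
    (hu : lowerCentral F A 1 ≤ Submodule.span F {a * b} ⊔ lowerCentral F A 2)
    (hac : a * c ∈ lowerCentral F A 2) (hbc : b * c ∈ lowerCentral F A 2)
    (h4 : lowerCentral F A 4 = ⊥)
    (h22 : ∀ x ∈ lowerCentral F A 2, ∀ y ∈ lowerCentral F A 2, x * y = 0) :
    ∀ w ∈ lowerCentral F A 1, ∀ x y, jacobian w x y = 0 := by
  have hu1 : a * b ∈ lowerCentral F A 1 := mul_mem_lowerCentral_one a b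
  have hv := lowerCentral_two_le h h2 hgen hu1 hu
  have c3 : ∀ {x : A} (y : A), x ∈ lowerCentral F A 3 → x * y = 0 :=
    fun y hx => h.mul_eq_zero_of_lowerCentral h4 y hx
  have c3' : ∀ {x : A} (y : A), x ∈ lowerCentral F A 3 → y * x = 0 :=
    fun y hx => mul_eq_zero_of_lowerCentral h4 y hx
  have m3 : ∀ {x : A} (y : A), x ∈ lowerCentral F A 2 → y * x ∈ lowerCentral F A 3 :=
    fun y hx => mul_mem_lowerCentral y hx
  have m2 : ∀ {x : A} (y : A), x ∈ lowerCentral F A 1 → y * x ∈ lowerCentral F A 2 :=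
    fun y hx => mul_mem_lowerCentral y hx
  have m2' : ∀ {x : A} (y : A), x ∈ lowerCentral F A 1 → x * y ∈ lowerCentral F A 2 :=
    fun y hx => h.mul_mem_lowerCentral y hx
  have hca : c * a ∈ lowerCentral F A 2 := by rw [h]; exact neg_mem hac
  have hcb : c * b ∈ lowerCentral F A 2 := by rw [h]; exact neg_mem hbc
  have h11 : ∀ x y, (a * b) * (x * y) ∈ lowerCentral F A 3 := fun x y =>
    mul_mem_lowerCentral_three h h2 hu hu1 (mul_mem_lowerCentral_one x y)
  have hself := fun x : A => h.mul_self h2 x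
  have hug : ∀ g, (a * b) * (g * (a * b)) = 0 := by
    intro g
    -- Applied to ab, the right-hand side consists of products with L_3 and vanishes; on the left
    -- only -u(gu) survives.
    have e := hcd.left_identity g (a * b) a b
    rw [hself, mul_zero, zero_sub, c3 b (sub_mem (m3 g (m2' a hu1)) (h11 g a)),
      c3' a (sub_mem (m3 g (m2' b hu1)) (h11 g b)), add_zero, neg_eq_zero] at e
    exact e
  have hu2 : ∀ v ∈ lowerCentral F A 2, (a * b) * v = 0 := fun v hv' => by
    have : v ∈ LinearMap.ker (LinearMap.mulLeft F (a * b)) := by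
      refine (hv.trans (sup_le (Submodule.span_le.2 ?_) fun w hw => ?_)) hv'
      · rintro _ ⟨x, _, rfl⟩
        exact hug x
      · exact c3' _ hw
    exact this
  have hauc : (a * (a * b)) * c = 0 := by
    have e := hcd.left_identity a b a c
    rw [c3' a (m3 b hac), c3' b (m3 a hac), hself a, mul_zero, c3' a (sub_mem (m3 a hbc) (m3 b hac)),
      h b a] at e
    simpa using e
  have hbuc : (b * (a * b)) * c = 0 := by
    have e := hcd.left_identity a b b c
    rw [c3' a (m3 b hbc), c3' b (m3 a hbc), hself b, mul_zero,
      c3' b (sub_mem (m3 a hbc) (m3 b hac))] at e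
    simpa using e
  have hcua : (c * (a * b)) * a = 0 := by
    -- Since c(au) = 0 is already known, this leaves a(cu) = -a(cu).
    have e := hcd.left_identity a c a b
    rw [h c (a * (a * b)), hauc, hself a, mul_zero, sub_zero, c3 b (m3 a hca), mul_sub,
      c3' a (m3 a hcb)] at e
    rw [h]
    rw [neg_eq_zero]
    exact eq_zero_of_eq_neg h2 (by simpa using e)
  have hcub : (c * (a * b)) * b = 0 := by
    have e := hcd.left_identity b c a b
    rw [h c (b * (a * b)), hbuc, hself b, mul_zero, sub_zero, c3' a (m3 b hcb), sub_mul,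
      c3 b (m3 b hca), h b a, mul_neg, neg_mul] at e
    refine eq_zero_of_eq_neg h2 ?_
    rw [h b] at e
    simp only [neg_zero, sub_zero, zero_sub, neg_neg, add_zero] at e
    exact e.symm
  have hu0 := hcd.jacobian_mul_self h h2 a b
  refine jacobian_lowerCentral_one_eq_zero_of_three h h2 hgen hu h4 h22 hu2 hu0 ?_ ?_
  · rw [jacobian, hcua, h (a * b) a, neg_mul, hauc, h (a * c), hu2 _ hac]
    simp
  · rw [jacobian, hcub, h (a * b) b, neg_mul, hbuc, h (b * c), hu2 _ hbc]
    simp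

/-- The crux is that J(a, b, c) is central. Modulo L_3 it equals (ab)c, an element of L_2 which the
Malcev identity shows to be annihilated by all of A. -/
theorem IsMalcevAlgebra.jacobian_eq_zero_of_three (hM : IsMalcevAlgebra A) (h2 : (2 : F) ≠ 0)
    (hgen : ⊤ ≤ Submodule.span F {a, b, c} ⊔ lowerCentral F A 1)
    (hu : lowerCentral F A 1 ≤ Submodule.span F {a * b} ⊔ lowerCentral F A 2)
    (hac : a * c ∈ lowerCentral F A 2) (hbc : b * c ∈ lowerCentral F A 2)
    (h3 : lowerCentral F A 3 ≠ ⊥) (h4 : lowerCentral F A 4 = ⊥)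
    (hline : ∀ v ∈ lowerCentral F A 2, v ∉ lowerCentral F A 3 →
      lowerCentral F A 2 ≤ Submodule.span F {v} ⊔ lowerCentral F A 3)
    (h22 : ∀ x ∈ lowerCentral F A 2, ∀ y ∈ lowerCentral F A 2, x * y = 0) :
    (∀ w ∈ lowerCentral F A 1, ∀ x y, jacobian w x y = 0) ∧
      ∀ x y z w : A, jacobian x y z * w = 0 := by
  have h := hM.anticommutative
  have hu1 : a * b ∈ lowerCentral F A 1 := mul_mem_lowerCentral_one a b
  have hv := lowerCentral_two_le h h2 hgen hu1 hu
  have c3 : ∀ {x : A} (y : A), x ∈ lowerCentral F A 3 → x * y = 0 :=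
    fun y hx => h.mul_eq_zero_of_lowerCentral h4 y hx
  have c3' : ∀ {x : A} (y : A), x ∈ lowerCentral F A 3 → y * x = 0 :=
    fun y hx => mul_eq_zero_of_lowerCentral h4 y hx
  have m3 : ∀ {x : A} (y : A), x ∈ lowerCentral F A 2 → y * x ∈ lowerCentral F A 3 :=
    fun y hx => mul_mem_lowerCentral y hx
  have m3' : ∀ {x : A} (y : A), x ∈ lowerCentral F A 2 → x * y ∈ lowerCentral F A 3 :=
    fun y hx => h.mul_mem_lowerCentral y hx
  have m2 : ∀ {x : A} (y : A), x ∈ lowerCentral F A 1 → y * x ∈ lowerCentral F A 2 :=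
    fun y hx => mul_mem_lowerCentral y hx
  have hca : c * a ∈ lowerCentral F A 2 := by rw [h]; exact neg_mem hac
  have hcb : c * b ∈ lowerCentral F A 2 := by rw [h]; exact neg_mem hbc
  have hJ2 : ∀ x y, ∀ v ∈ lowerCentral F A 2, jacobian x y v = (x * y) * v := by
    intro x y v hv
    rw [jacobian, c3 x (m3 y hv), c3 y (m3' x hv)]; simp
  have hmem : ∀ x y z : A, jacobian x y z ∈ lowerCentral F A 2 := fun x y z =>
    add_mem (add_mem (h.mul_mem_lowerCentral z (mul_mem_lowerCentral_one x y))
      (h.mul_mem_lowerCentral x (mul_mem_lowerCentral_one y z)))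
      (h.mul_mem_lowerCentral y (mul_mem_lowerCentral_one z x))
  have hu0 : jacobian a b (a * b) = 0 := by rw [hM.malcev, h.jacobian_self_right h2, zero_mul]
  have hua : (a * b) * (a * (a * b)) = 0 := by
    rw [← hJ2 a b _ (m2 a hu1), hM.malcev, hu0, zero_mul]
  have hub : (a * b) * (b * (a * b)) = 0 := by
    rw [← hJ2 a b _ (m2 b hu1), hM.jacobian_mul_right, hu0, zero_mul]
  have huc : (a * b) * (c * (a * b)) = 0 := by
    -- Polarizing in a and c adds only (cb)(au), which lies in L_2 L_2 = 0, and products with L_3.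
    have e := hM.linearized a b (a * b) c
    have e1 : jacobian c b (a * b) ∈ lowerCentral F A 3 := by
      rw [h a b, jacobian_neg, hM.jacobian_mul_right]
      exact neg_mem (m3' b (hmem _ _ _))
    rw [hu0, c3 a e1, hJ2 a b _ (m2 c hu1), hJ2 c b _ (m2 a hu1), h22 _ hcb _ (m2 a hu1)] at e
    simpa using e
  have hu2 : ∀ v ∈ lowerCentral F A 2, (a * b) * v = 0 := fun v hv' => by
    have : v ∈ LinearMap.ker (LinearMap.mulLeft F (a * b)) := by
      refine (hv.trans (sup_le (Submodule.span_le.2 ?_) fun w hw => ?_)) hv'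
      · rintro _ ⟨x, (rfl | rfl | rfl), rfl⟩
        exacts [hua, hub, huc]
      · exact c3' _ hw
    exact this
  have hJc : ∀ x, jacobian a b c * x = (a * b) * c * x := fun x => by
    rw [jacobian, add_mul, add_mul, c3 x (m3' a hbc), c3 x (m3' b hca)]; simp
  have hka : (a * b) * c * a = 0 := by
    rw [← hJc, ← hM.malcev, hJ2 a b _ hac, hu2 _ hac]
  have hkb : (a * b) * c * b = 0 := by
    rw [← hJc, ← hM.jacobian_mul_right, hJ2 a b _ hbc, hu2 _ hbc]
  have hkc : (a * b) * c * c = 0 := by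
    rw [← hJc, ← jacobian_rotate, ← hM.malcev, hJ2 c a _ hcb, h22 _ hca _ hcb]
  have hk2 : (a * b) * c ∈ lowerCentral F A 2 := h.mul_mem_lowerCentral c hu1
  have hk : ∀ x, x * ((a * b) * c) = 0 := fun x => by
    have hx : x ∈ LinearMap.ker (LinearMap.mulLeft F ((a * b) * c)) := by
      refine (hgen.trans (sup_le (Submodule.span_le.2 ?_)
        (hu.trans (sup_le (Submodule.span_le.2 ?_) fun w hw => ?_)))) Submodule.mem_top
      · rintro x (rfl | rfl | rfl)
        exacts [hka, hkb, hkc]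
      · rintro _ rfl
        change (a * b) * c * (a * b) = 0
        rw [h, hu2 _ hk2, neg_zero]
      · exact h22 _ hk2 _ hw
    rw [h, neg_eq_zero]
    exact hx
  have hk3 : (a * b) * c ∈ lowerCentral F A 3 := by
    -- Otherwise (ab)c would span L_2 modulo L_3, so A would annihilate L_2 and L_3 would be 0.
    by_contra hk3
    refine h3 (le_bot_iff.1 (lowerCentral_succ_le_of fun x y hy => ?_))
    refine mul_mem_of_le_span_sup (le_sup_right (a := Submodule.span F ∅)) (hline _ hk2 hk3)
      ?_ ?_ ?_ ?_ (Submodule.mem_top (x := x)) hy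
    · simp
    · simp
    · rintro x - _ rfl; exact hk x
    · exact fun x _ y hy => c3' x hy
  have hJ3 : jacobian a b c ∈ lowerCentral F A 3 :=
    add_mem (add_mem hk3 (m3' a hbc)) (m3' b hca)
  have h1 := jacobian_lowerCentral_one_eq_zero_of_three h h2 hgen hu h4 h22 hu2 hu0
    (by rw [hM.malcev, h.jacobian_swap_right, neg_mul, c3 a hJ3, neg_zero])
    (by rw [h a b, jacobian_neg, hM.malcev, ← jacobian_rotate, c3 b hJ3, neg_zero])
  refine ⟨h1, fun x y z w => c3 w (jacobian_mem_of_three h h2 hgen hJ3 (fun u hu x y => ?_) x y z)⟩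
  rw [h1 u hu]; exact zero_mem _

end ThreeGenerators

/-! ### The case L_3 = 0 and the algebras B_{6,1}^α. -/

section ClassThree

variable {F : Type*} [Field F] {A : Type*} [NonUnitalNonAssocRing A] [Module F A]
  [IsScalarTower F A A] [SMulCommClass F A A] {a b c : A}

theorem jacobian_eq_zero_of_lowerCentral_three_eq_bot (h : IsAnticommutative A)
    (h3 : lowerCentral F A 3 = ⊥)
    (h11 : ∀ x ∈ lowerCentral F A 1, ∀ y ∈ lowerCentral F A 1, x * y = 0) :
    (∀ w ∈ lowerCentral F A 1, ∀ x y, jacobian w x y = 0) ∧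
      ∀ x y z w : A, jacobian x y z * w = 0 := by
  have c2 : ∀ {x : A} (y : A), x ∈ lowerCentral F A 2 → x * y = 0 :=
    fun y hx => h.mul_eq_zero_of_lowerCentral h3 y hx
  refine ⟨fun w hw x y => ?_, fun x y z w => c2 w ?_⟩
  · rw [jacobian, c2 y (h.mul_mem_lowerCentral x hw), c2 x (mul_mem_lowerCentral y hw),
      h11 _ (mul_mem_lowerCentral_one x y) _ hw]
    simp
  · exact add_mem (add_mem (h.mul_mem_lowerCentral z (mul_mem_lowerCentral_one x y))
      (h.mul_mem_lowerCentral x (mul_mem_lowerCentral_one y z)))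
      (h.mul_mem_lowerCentral y (mul_mem_lowerCentral_one z x))

theorem lowerCentral_one_le_of_three (h : IsAnticommutative A) (h2 : (2 : F) ≠ 0)
    (hgen : ⊤ ≤ Submodule.span F {a, b, c} ⊔ lowerCentral F A 1) :
    lowerCentral F A 1 ≤ Submodule.span F {a * b, a * c, b * c} ⊔ lowerCentral F A 2 := by
  refine lowerCentral_succ_le_of fun x y _ => mul_mem_of_le_span_sup hgen hgen ?_
    (fun x _ y hy => Submodule.mem_sup_right (mul_mem_lowerCentral x hy))
    (fun x hx y _ => Submodule.mem_sup_right (h.mul_mem_lowerCentral y hx))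
    (fun x hx y _ => Submodule.mem_sup_right (h.mul_mem_lowerCentral y hx))
    (Submodule.mem_top (x := x)) (Submodule.mem_top (x := y))
  set K := Submodule.span F {a * b, a * c, b * c} ⊔ lowerCentral F A 2
  have m1 : a * b ∈ K := Submodule.mem_sup_left (Submodule.subset_span (by simp))
  have m2 : a * c ∈ K := Submodule.mem_sup_left (Submodule.subset_span (by simp))
  have m3 : b * c ∈ K := Submodule.mem_sup_left (Submodule.subset_span (by simp))
  have d : ∀ x : A, x * x ∈ K := fun x => by rw [h.mul_self h2]; exact zero_mem _
  have n : ∀ {x y : A}, x * y ∈ K → y * x ∈ K := fun {x y} hxy => by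
    rw [h]; exact neg_mem hxy
  intro x hx y hy
  simp only [Set.mem_insert_iff, Set.mem_singleton_iff] at hx hy
  rcases hx with hx | hx | hx <;> rcases hy with hy | hy | hy <;> rw [hx, hy] <;>
    first | assumption | exact d _ | exact n ‹_›

/-- With L_3 = 0 the Malcev identity collapses to (xy)(xz) = 0, and any two of ab, ac, bc share a
factor. -/
theorem IsMalcevAlgebra.mul_lowerCentral_one_eq_zero (hM : IsMalcevAlgebra A) (h2 : (2 : F) ≠ 0)
    (hgen : ⊤ ≤ Submodule.span F {a, b, c} ⊔ lowerCentral F A 1)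
    (h3 : lowerCentral F A 3 = ⊥) :
    ∀ x ∈ lowerCentral F A 1, ∀ y ∈ lowerCentral F A 1, x * y = 0 := by
  have h := hM.anticommutative
  have hL1 := lowerCentral_one_le_of_three h h2 hgen
  have c2 : ∀ {x : A} (y : A), x ∈ lowerCentral F A 2 → x * y = 0 :=
    fun y hx => h.mul_eq_zero_of_lowerCentral h3 y hx
  have c2' : ∀ {x : A} (y : A), x ∈ lowerCentral F A 2 → y * x = 0 :=
    fun y hx => mul_eq_zero_of_lowerCentral h3 y hx
  have key : ∀ x y z : A, (x * y) * (x * z) = 0 := fun x y z => by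
    have e := hM.malcev x y z
    have e1 : jacobian x y z ∈ lowerCentral F A 2 :=
      add_mem (add_mem (h.mul_mem_lowerCentral z (mul_mem_lowerCentral_one x y))
      (h.mul_mem_lowerCentral x (mul_mem_lowerCentral_one y z)))
      (h.mul_mem_lowerCentral y (mul_mem_lowerCentral_one z x))
    rw [c2 x e1, jacobian, c2 x (mul_mem_lowerCentral y (mul_mem_lowerCentral_one x z)),
      c2 y (h.mul_mem_lowerCentral x (mul_mem_lowerCentral_one x z))] at e
    simpa using e
  have key1 : ∀ x y z : A, (x * y) * (y * z) = 0 := fun x y z => by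
    rw [h x y, neg_mul, key, neg_zero]
  have key2 : ∀ x y z : A, (x * y) * (z * y) = 0 := fun x y z => by
    rw [h z y, mul_neg, key1, neg_zero]
  have key3 : ∀ x y z : A, (x * y) * (z * x) = 0 := fun x y z => by
    rw [h z x, mul_neg, key, neg_zero]
  intro x hx y hy
  refine mul_mem_of_le_span_sup (K := ⊥) hL1 hL1 ?_ (fun x _ y hy => c2' x hy)
    (fun x hx y _ => c2 y hx) (fun x hx y _ => c2 y hx) hx hy
  rintro x (rfl | rfl | rfl) y (rfl | rfl | rfl) <;>
    first | exact key _ _ _ | exact key1 _ _ _ | exact key2 _ _ _ | exact key3 _ _ _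

/-- The standard multiplication table of `B61` determines the algebra. -/
theorem algebrasIsomorphic_B61_of_table (h : IsAnticommutative A) (h2 : (2 : F) ≠ 0)
    (hdim : Module.finrank F A = 6) {p q e : A} {α : F}
    (hspan : ⊤ ≤ Submodule.span F (Set.range ![a, b, c, p, q, e]))
    (hab : a * b = p) (hac : a * c = q) (hbc : b * c = α • e) (hpq : p * q = e)
    (hap : a * p = 0) (haq : a * q = 0) (hbp : b * p = 0) (hbq : b * q = 0) (hcp : c * p = 0)
    (hcq : c * q = 0) (he : ∀ x, x * e = 0) : AlgebrasIsomorphic F A (B61 α) := by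
  let B := basisOfTopLeSpanOfCardEqFinrank ![a, b, c, p, q, e] hspan (by simp [hdim])
  have hB : ∀ i, B i = ![a, b, c, p, q, e] i := fun i => by
    simp only [B, coe_basisOfTopLeSpanOfCardEqFinrank]
  have hself := fun x : A => h.mul_self h2 x
  have he' : ∀ x, e * x = 0 := fun x => by rw [h, he, neg_zero]
  have hba : b * a = -p := by rw [h, hab]
  have hca : c * a = -q := by rw [h, hac]
  have hcb : c * b = -(α • e) := by rw [h, hbc]
  have hqp : q * p = -e := by rw [h, hpq]
  have hpa : p * a = 0 := by rw [h, hap, neg_zero]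
  have hqa : q * a = 0 := by rw [h, haq, neg_zero]
  have hpb : p * b = 0 := by rw [h, hbp, neg_zero]
  have hqb : q * b = 0 := by rw [h, hbq, neg_zero]
  have hpc : p * c = 0 := by rw [h, hcp, neg_zero]
  have hqc : q * c = 0 := by rw [h, hcq, neg_zero]
  have key : ∀ X Y : Fin 6 → F,
      B.equivFun.symm (B61.product α X Y) = B.equivFun.symm X * B.equivFun.symm Y := by
    intro X Y
    simp only [Module.Basis.equivFun_symm_apply, hB, Fin.sum_univ_six, B61.product]
    simp [mul_add, add_mul, smul_mul_assoc, mul_smul_comm, hself, he, he', hab, hba, hac, hca,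
      hbc, hcb, hpq, hqp, hap, hpa, haq, hqa, hbp, hpb, hbq, hqb, hcp, hpc, hcq, hqc]
    module
  refine ⟨B.equivFun, fun x y => ?_⟩
  change B.equivFun (x * y) = B61.product α (B.equivFun x) (B.equivFun y)
  rw [← LinearEquiv.eq_symm_apply, key, LinearEquiv.symm_apply_apply, LinearEquiv.symm_apply_apply]

/-- The product makes the span of p = ab and q = ac a symplectic plane with values in the line L_2.
Correcting a, b, c by elements of this plane makes them orthogonal to it and changes ab, ac, bc only
within L_2, so α is the coefficient of bc. -/
theorem algebrasIsomorphic_B61_of_mul_mem (h : IsAnticommutative A) (h2 : (2 : F) ≠ 0)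
    (hdim : Module.finrank F A = 6)
    (hgen : ⊤ ≤ Submodule.span F {a, b, c} ⊔ lowerCentral F A 1)
    (hbc : b * c ∈ lowerCentral F A 2) (h3 : lowerCentral F A 3 = ⊥)
    (hline : ∀ v ∈ lowerCentral F A 2, v ≠ 0 → lowerCentral F A 2 ≤ Submodule.span F {v})
    (hne : ∃ x ∈ lowerCentral F A 1, ∃ y ∈ lowerCentral F A 1, x * y ≠ 0) :
    ∃ α : F, AlgebrasIsomorphic F A (B61 α) := by
  have c2 : ∀ {x : A} (y : A), x ∈ lowerCentral F A 2 → x * y = 0 :=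
    fun y hx => h.mul_eq_zero_of_lowerCentral h3 y hx
  have c2' : ∀ {x : A} (y : A), x ∈ lowerCentral F A 2 → y * x = 0 :=
    fun y hx => mul_eq_zero_of_lowerCentral h3 y hx
  have hself := fun x : A => h.mul_self h2 x
  have hL1 : lowerCentral F A 1 ≤ Submodule.span F {a * b, a * c} ⊔ lowerCentral F A 2 := by
    refine (lowerCentral_one_le_of_three h h2 hgen).trans
      (sup_le (Submodule.span_le.2 ?_) le_sup_right)
    rintro x (rfl | rfl | rfl)
    · exact Submodule.mem_sup_left (Submodule.subset_span (by simp))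
    · exact Submodule.mem_sup_left (Submodule.subset_span (by simp))
    · exact Submodule.mem_sup_right hbc
  have hp1 : a * b ∈ lowerCentral F A 1 := mul_mem_lowerCentral_one a b
  have hq1 : a * c ∈ lowerCentral F A 1 := mul_mem_lowerCentral_one a c
  set p := a * b with hp
  set q := a * c with hq
  have he0 : p * q ≠ 0 := by
    intro he0
    obtain ⟨x, hx, y, hy, hxy⟩ := hne
    refine hxy (mul_mem_of_le_span_sup (K := ⊥) hL1 hL1 ?_ (fun x _ y hy => c2' x hy)
      (fun x hx y _ => c2 y hx) (fun x hx y _ => c2 y hx) hx hy)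
    rintro x (rfl | rfl) y (rfl | rfl)
    · exact hself _
    · exact he0
    · change q * p = 0
      rw [h, he0, neg_zero]
    · exact hself _
  have he2 : p * q ∈ lowerCentral F A 2 := mul_mem_lowerCentral p hq1
  set e := p * q with hedef
  have hLe := hline e he2 he0
  have hshift : ∀ x : A, ∃ y ∈ lowerCentral F A 1, (x + y) * p = 0 ∧ (x + y) * q = 0 := by
    intro x
    obtain ⟨l, hl⟩ := Submodule.mem_span_singleton.1 (hLe (mul_mem_lowerCentral x hp1))
    obtain ⟨k, hk⟩ := Submodule.mem_span_singleton.1 (hLe (mul_mem_lowerCentral x hq1))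
    have hqp : q * p = -e := h q p
    -- With xp = le and xq = ke, the correction contributes l(qp) = -le and -k(pq) = -ke.
    refine ⟨l • q - k • p, sub_mem (Submodule.smul_mem _ _ hq1) (Submodule.smul_mem _ _ hp1),
      ?_, ?_⟩
    · rw [add_mul, sub_mul, smul_mul_assoc, smul_mul_assoc, hself, ← hl, hqp]; module
    · rw [add_mul, sub_mul, smul_mul_assoc, smul_mul_assoc, hself, ← hk, ← hedef]; module
  obtain ⟨a1, ha1, hap, haq⟩ := hshift a
  obtain ⟨b1, hb1, hbp, hbq⟩ := hshift b
  obtain ⟨c1, hc1, hcp, hcq⟩ := hshift c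
  have hmul : ∀ x y x1 y1 : A, x1 ∈ lowerCentral F A 1 → y1 ∈ lowerCentral F A 1 →
      ∃ l ∈ lowerCentral F A 2, (x + x1) * (y + y1) = x * y + l := by
    intro x y x1 y1 hx hy
    refine ⟨x * y1 + x1 * (y + y1), add_mem (mul_mem_lowerCentral x hy)
      (h.mul_mem_lowerCentral _ hx), ?_⟩
    simp only [mul_add, add_mul]; abel
  obtain ⟨l, hl, hab'⟩ := hmul a b a1 b1 ha1 hb1
  obtain ⟨k, hk, hac'⟩ := hmul a c a1 c1 ha1 hc1
  obtain ⟨m, hm, hbc'⟩ := hmul b c b1 c1 hb1 hc1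
  obtain ⟨α, hα⟩ := Submodule.mem_span_singleton.1 (hLe (add_mem hbc hm))
  refine ⟨α, algebrasIsomorphic_B61_of_table h h2 hdim (a := a + a1) (b := b + b1) (c := c + c1)
    (p := p + l) (q := q + k) (e := e) ?_ hab' hac' (by rw [hbc', hα]) ?_ ?_ ?_ ?_ ?_ ?_ ?_ ?_⟩
  · set S := Submodule.span F (Set.range ![a + a1, b + b1, c + c1, p + l, q + k, e])
    have hS : ∀ i, ![a + a1, b + b1, c + c1, p + l, q + k, e] i ∈ S :=
      fun i => Submodule.subset_span ⟨i, rfl⟩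
    have hS2 : lowerCentral F A 2 ≤ S := hLe.trans (Submodule.span_le.2 (by
      rintro _ rfl; exact hS 5))
    have hS1 : lowerCentral F A 1 ≤ S := by
      refine hL1.trans (sup_le (Submodule.span_le.2 ?_) hS2)
      rintro _ (rfl | rfl)
      · exact (Submodule.add_mem_iff_left _ (hS2 hl)).1 (hS 3)
      · exact (Submodule.add_mem_iff_left _ (hS2 hk)).1 (hS 4)
    refine hgen.trans (sup_le (Submodule.span_le.2 ?_) hS1)
    rintro _ (rfl | rfl | rfl)
    · exact (Submodule.add_mem_iff_left _ (hS1 ha1)).1 (hS 0)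
    · exact (Submodule.add_mem_iff_left _ (hS1 hb1)).1 (hS 1)
    · exact (Submodule.add_mem_iff_left _ (hS1 hc1)).1 (hS 2)
  · rw [mul_add, add_mul, c2' _ hk, c2 _ hl, ← hedef]; simp
  · rw [mul_add, hap, c2' _ hl, add_zero]
  · rw [mul_add, haq, c2' _ hk, add_zero]
  · rw [mul_add, hbp, c2' _ hl, add_zero]
  · rw [mul_add, hbq, c2' _ hk, add_zero]
  · rw [mul_add, hcp, c2' _ hl, add_zero]
  · rw [mul_add, hcq, c2' _ hk, add_zero]
  · exact fun x => c2' x he2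

end ClassThree

/-! ### Linear algebra: spanning modulo a subspace. -/

section Generators

variable {F : Type*} [Field F] {A : Type*} [AddCommGroup A] [Module F A]

theorem exists_sub_smul_mem {U : Submodule F A} {v x : A}
    (hx : x ∈ Submodule.span F {v} ⊔ U) : ∃ t : F, x - t • v ∈ U := by
  obtain ⟨y, hy, l, hl, rfl⟩ := Submodule.mem_sup.1 hx
  obtain ⟨t, rfl⟩ := Submodule.mem_span_singleton.1 hy
  exact ⟨t, by simpa using hl⟩

theorem le_span_singleton_sup_of_finrank_le [FiniteDimensional F A] {U V : Submodule F A}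
    (hUV : U ≤ V) (hr : Module.finrank F V ≤ Module.finrank F U + 1) {v : A} (hv : v ∈ V)
    (hvU : v ∉ U) : V ≤ Submodule.span F {v} ⊔ U := by
  have hlt : U < Submodule.span F {v} ⊔ U := by
    refine lt_of_le_of_ne le_sup_right fun heq => hvU ?_
    rw [heq]
    exact Submodule.mem_sup_left (Submodule.mem_span_singleton_self v)
  have hle : Submodule.span F {v} ⊔ U ≤ V :=
    sup_le ((Submodule.span_singleton_le_iff_mem _ _).2 hv) hUV
  have := Submodule.finrank_lt_finrank_of_lt hlt
  exact (Submodule.eq_of_le_of_finrank_le hle (by omega)).ge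

theorem exists_generators [FiniteDimensional F A] (U : Submodule F A) {n : ℕ}
    (hn : Module.finrank F A ≤ Module.finrank F U + n) :
    ∃ g : Fin n → A, ⊤ ≤ Submodule.span F (Set.range g) ⊔ U := by
  have hQ := Submodule.finrank_quotient_add_finrank U
  obtain ⟨m, hm⟩ : ∃ m, Module.finrank F (A ⧸ U) = m := ⟨_, rfl⟩
  let B := Module.finBasisOfFinrankEq F (A ⧸ U) hm
  choose g hg using fun i => U.mkQ_surjective (B i)
  -- The quotient may have dimension smaller than n; the list is then padded with zeros.
  refine ⟨fun i => if hi : (i : ℕ) < m then g ⟨i, hi⟩ else 0, ?_⟩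
  have h1 : Submodule.map U.mkQ (Submodule.span F (Set.range g)) = ⊤ := by
    rw [Submodule.map_span, ← Set.range_comp]
    have : (U.mkQ ∘ g) = B := funext hg
    rw [this, B.span_eq]
  have h2 : Submodule.span F (Set.range g) ⊔ U = ⊤ := by
    rw [sup_comm, ← Submodule.comap_map_mkQ, h1, Submodule.comap_top]
  rw [← h2]
  refine sup_le_sup_right (Submodule.span_mono ?_) U
  rintro _ ⟨i, rfl⟩
  exact ⟨⟨i, by omega⟩, by simp⟩

end Generators

/-! ### Generators adapted to the lower central series. -/

section Adapted

variable {F : Type*} [Field F] {A : Type*} [NonUnitalNonAssocRing A] [Module F A]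
  [IsScalarTower F A A] [SMulCommClass F A A] [FiniteDimensional F A]

theorem exists_two_generators
    (hr : Module.finrank F A ≤ Module.finrank F (lowerCentral F A 1) + 2) :
    ∃ a b : A, ⊤ ≤ Submodule.span F {a, b} ⊔ lowerCentral F A 1 := by
  obtain ⟨g, hg⟩ := exists_generators _ hr
  refine ⟨g 0, g 1, hg.trans (sup_le_sup_right (Submodule.span_mono ?_) _)⟩
  rintro _ ⟨i, rfl⟩
  fin_cases i <;> simp

theorem exists_three_generators
    (hr : Module.finrank F A ≤ Module.finrank F (lowerCentral F A 1) + 3) :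
    ∃ a b c : A, ⊤ ≤ Submodule.span F {a, b, c} ⊔ lowerCentral F A 1 := by
  obtain ⟨g, hg⟩ := exists_generators _ hr
  refine ⟨g 0, g 1, g 2, hg.trans (sup_le_sup_right (Submodule.span_mono ?_) _)⟩
  rintro _ ⟨i, rfl⟩
  fin_cases i <;> simp

/-- With a single generator g modulo L_1, gg = 0 would give L_1 = L_2. -/
theorem finrank_lowerCentral_one_add_two_le (h : IsAnticommutative A) (h2 : (2 : F) ≠ 0)
    (hlt : lowerCentral F A 2 < lowerCentral F A 1) :
    Module.finrank F (lowerCentral F A 1) + 2 ≤ Module.finrank F A := by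
  by_contra hr
  obtain ⟨g, hg⟩ := exists_generators (n := 1) (lowerCentral F A 1) (by omega)
  have hg' : ⊤ ≤ Submodule.span F {g 0, g 0} ⊔ lowerCentral F A 1 := by
    refine hg.trans (sup_le_sup_right (Submodule.span_mono ?_) _)
    rintro _ ⟨i, rfl⟩
    fin_cases i; simp
  have := lowerCentral_one_le_of_two h h2 hg'
  rw [h.mul_self h2, Submodule.span_singleton_eq_bot.2 rfl, bot_sup_eq] at this
  exact hlt.not_ge this

theorem exists_adapted_two_generators (h : IsAnticommutative A) (h2 : (2 : F) ≠ 0)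
    (hr1 : Module.finrank F A ≤ Module.finrank F (lowerCentral F A 1) + 2)
    (hr2 : Module.finrank F (lowerCentral F A 2) ≤ Module.finrank F (lowerCentral F A 3) + 1)
    (hlt : lowerCentral F A 3 < lowerCentral F A 2) :
    ∃ a b : A, ⊤ ≤ Submodule.span F {a, b} ⊔ lowerCentral F A 1 ∧
      lowerCentral F A 2 ≤ Submodule.span F {a * (a * b)} ⊔ lowerCentral F A 3 ∧
      b * (a * b) ∈ lowerCentral F A 3 := by
  have hmem : ∀ x y z : A, x * (y * z) ∈ lowerCentral F A 2 := fun x y z =>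
    mul_mem_lowerCentral x (mul_mem_lowerCentral_one y z)
  have key : ∀ a b : A, ⊤ ≤ Submodule.span F {a, b} ⊔ lowerCentral F A 1 →
      a * (a * b) ∉ lowerCentral F A 3 → ∃ b' : A,
      ⊤ ≤ Submodule.span F {a, b'} ⊔ lowerCentral F A 1 ∧
      lowerCentral F A 2 ≤ Submodule.span F {a * (a * b')} ⊔ lowerCentral F A 3 ∧
      b' * (a * b') ∈ lowerCentral F A 3 := by
    intro a b hgen hab
    have hline := le_span_singleton_sup_of_finrank_le hlt.le hr2 (hmem a a b) hab
    obtain ⟨t, ht⟩ := exists_sub_smul_mem (hline (hmem b a b))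
    have e : a * (b - t • a) = a * b := by
      rw [mul_sub, mul_smul_comm, h.mul_self h2, smul_zero, sub_zero]
    -- Subtracting a multiple of a leaves ab unchanged and clears b(ab) modulo L_3.
    refine ⟨b - t • a, hgen.trans (sup_le (Submodule.span_le.2 ?_) le_sup_right), ?_, ?_⟩
    · have ma : a ∈ Submodule.span F {a, b - t • a} := Submodule.subset_span (by simp)
      have mb : b - t • a ∈ Submodule.span F {a, b - t • a} := Submodule.subset_span (by simp)
      rintro _ (rfl | rfl)
      · exact Submodule.mem_sup_left ma
      · exact Submodule.mem_sup_left
          ((Submodule.sub_mem_iff_left _ (Submodule.smul_mem _ t ma)).1 mb)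
    · rwa [e]
    · rwa [e, sub_mul, smul_mul_assoc]
  obtain ⟨a, b, hgen⟩ := exists_two_generators hr1
  by_cases ha : a * (a * b) ∈ lowerCentral F A 3
  · by_cases hb : b * (b * a) ∈ lowerCentral F A 3
    · have hv := lowerCentral_two_le h h2 hgen (mul_mem_lowerCentral_one a b)
        (lowerCentral_one_le_of_two h h2 hgen)
      refine absurd (hv.trans (sup_le (Submodule.span_le.2 ?_) le_rfl)) hlt.not_ge
      rintro _ ⟨x, (rfl | rfl), rfl⟩
      · exact ha
      · change x * (a * x) ∈ lowerCentral F A 3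
        rw [h a x, mul_neg]
        exact neg_mem hb
    · rw [Set.pair_comm] at hgen
      obtain ⟨a', h'⟩ := key b a hgen hb
      exact ⟨b, a', h'⟩
  · obtain ⟨b', h'⟩ := key a b hgen ha
    exact ⟨a, b', h'⟩

theorem exists_adapted_three_generators (h : IsAnticommutative A) (h2 : (2 : F) ≠ 0)
    (hr1 : Module.finrank F A ≤ Module.finrank F (lowerCentral F A 1) + 3)
    (hr2 : Module.finrank F (lowerCentral F A 1) ≤ Module.finrank F (lowerCentral F A 2) + 1)
    (hlt : lowerCentral F A 2 < lowerCentral F A 1) :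
    ∃ a b c : A, ⊤ ≤ Submodule.span F {a, b, c} ⊔ lowerCentral F A 1 ∧
      lowerCentral F A 1 ≤ Submodule.span F {a * b} ⊔ lowerCentral F A 2 ∧
      a * c ∈ lowerCentral F A 2 ∧ b * c ∈ lowerCentral F A 2 := by
  have key : ∀ a b c : A, ⊤ ≤ Submodule.span F {a, b, c} ⊔ lowerCentral F A 1 →
      a * b ∉ lowerCentral F A 2 → ∃ c' : A,
      ⊤ ≤ Submodule.span F {a, b, c'} ⊔ lowerCentral F A 1 ∧
      lowerCentral F A 1 ≤ Submodule.span F {a * b} ⊔ lowerCentral F A 2 ∧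
      a * c' ∈ lowerCentral F A 2 ∧ b * c' ∈ lowerCentral F A 2 := by
    intro a b c hgen hab
    have hline := le_span_singleton_sup_of_finrank_le hlt.le hr2 (mul_mem_lowerCentral_one a b) hab
    obtain ⟨t, ht⟩ := exists_sub_smul_mem (hline (mul_mem_lowerCentral_one a c))
    obtain ⟨s, hs⟩ := exists_sub_smul_mem (hline (mul_mem_lowerCentral_one b c))
    -- Here ac = t(ab) and bc = s(ab) modulo L_2; since ba = -ab, this correction clears both.
    refine ⟨c - (t • b - s • a), hgen.trans (sup_le (Submodule.span_le.2 ?_) le_sup_right), hline,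
      ?_, ?_⟩
    · set S := Submodule.span F {a, b, c - (t • b - s • a)}
      have ma : a ∈ S := Submodule.subset_span (by simp)
      have mb : b ∈ S := Submodule.subset_span (by simp)
      have mc : c - (t • b - s • a) ∈ S := Submodule.subset_span (by simp)
      rintro _ (rfl | rfl | rfl)
      · exact Submodule.mem_sup_left ma
      · exact Submodule.mem_sup_left mb
      · exact Submodule.mem_sup_left ((Submodule.sub_mem_iff_left _
          (sub_mem (Submodule.smul_mem _ t mb) (Submodule.smul_mem _ s ma))).1 mc)
    · rwa [mul_sub, mul_sub, mul_smul_comm, mul_smul_comm, h.mul_self h2, smul_zero, sub_zero]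
    · rwa [mul_sub, mul_sub, mul_smul_comm, mul_smul_comm, h.mul_self h2, smul_zero, zero_sub,
        h b a, smul_neg, neg_neg]
  obtain ⟨a, b, c, hgen⟩ := exists_three_generators hr1
  by_cases hab : a * b ∈ lowerCentral F A 2
  · by_cases hac : a * c ∈ lowerCentral F A 2
    · by_cases hbc : b * c ∈ lowerCentral F A 2
      · refine absurd ((lowerCentral_one_le_of_three h h2 hgen).trans
          (sup_le (Submodule.span_le.2 ?_) le_rfl)) hlt.not_ge
        rintro _ (rfl | rfl | rfl)
        exacts [hab, hac, hbc]
      · rw [Set.insert_comm, Set.pair_comm] at hgen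
        obtain ⟨c', h'⟩ := key b c a hgen hbc
        exact ⟨b, c, c', h'⟩
    · rw [Set.pair_comm] at hgen
      obtain ⟨c', h'⟩ := key a c b hgen hac
      exact ⟨a, c, c', h'⟩
  · obtain ⟨c', h'⟩ := key a b c hgen hab
    exact ⟨a, b, c', h'⟩

/-- A relation between the three products of generators can be brought to the form
`b * c ∈ A (A A)`. -/
theorem exists_three_generators_mul_mem (h : IsAnticommutative A) (h2 : (2 : F) ≠ 0)
    (hr : Module.finrank F A ≤ Module.finrank F (lowerCentral F A 1) + 3)
    (hr1 : Module.finrank F (lowerCentral F A 1) ≤ 3) (hne : lowerCentral F A 2 ≠ ⊥) :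
    ∃ a b c : A, ⊤ ≤ Submodule.span F {a, b, c} ⊔ lowerCentral F A 1 ∧
      b * c ∈ lowerCentral F A 2 := by
  obtain ⟨a, b, c, hgen⟩ := exists_three_generators hr
  obtain ⟨e, he, he0⟩ := Submodule.exists_mem_ne_zero_of_ne_bot hne
  -- Four vectors in a space of dimension at most three are dependent. As e ≠ 0 lies in L_2, the
  -- dependence is a nontrivial relation among ab, ac, bc modulo L_2.
  let w : Fin 4 → lowerCentral F A 1 := ![⟨a * b, mul_mem_lowerCentral_one a b⟩,
    ⟨a * c, mul_mem_lowerCentral_one a c⟩, ⟨b * c, mul_mem_lowerCentral_one b c⟩,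
    ⟨e, lowerCentral_succ_le 1 he⟩]
  have hw : ¬ LinearIndependent F w := fun hw => by
    have := hw.fintype_card_le_finrank
    simp at this
    omega
  obtain ⟨k, hk, i, hi⟩ := Fintype.not_linearIndependent_iff.1 hw
  have hk' := congrArg Subtype.val hk
  simp only [Fin.sum_univ_four, w, Submodule.coe_add, Submodule.coe_smul, Matrix.cons_val_zero,
    Matrix.cons_val_one, Matrix.cons_val, Submodule.coe_zero] at hk'
  have hrel : k 0 • (a * b) + k 1 • (a * c) + k 2 • (b * c) ∈ lowerCentral F A 2 := by
    rw [eq_neg_of_add_eq_zero_left hk']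
    exact neg_mem (Submodule.smul_mem _ _ he)
  by_cases k2 : k 2 = 0
  · by_cases k1 : k 1 = 0
    · by_cases k0 : k 0 = 0
      · exfalso
        rw [k0, k1, k2] at hk'
        have k3 : k 3 = 0 := by simpa [he0] using hk'
        fin_cases i <;> simp_all
      · refine ⟨c, a, b, ?_, ?_⟩
        · rwa [Set.insert_comm, Set.pair_comm c b]
        · rw [k1, k2] at hrel
          simpa [Submodule.smul_mem_iff _ k0] using hrel
    · refine ⟨b, a, k 0 • b + k 1 • c, hgen.trans (sup_le (Submodule.span_le.2 ?_) le_sup_right),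
        ?_⟩
      · set S := Submodule.span F {b, a, k 0 • b + k 1 • c}
        have ma : a ∈ S := Submodule.subset_span (by simp)
        have mb : b ∈ S := Submodule.subset_span (by simp)
        have mc : k 0 • b + k 1 • c ∈ S := Submodule.subset_span (by simp)
        rintro _ (rfl | rfl | rfl)
        · exact Submodule.mem_sup_left ma
        · exact Submodule.mem_sup_left mb
        · exact Submodule.mem_sup_left ((Submodule.smul_mem_iff _ k1).1
            ((Submodule.add_mem_iff_right _ (Submodule.smul_mem _ _ mb)).1 mc))
      · rw [k2] at hrel
        simpa [mul_add, mul_smul_comm] using hrel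
  -- Every bivector on a three-dimensional space is decomposable: the product of these two factors
  -- is k 2 times the relation.
  · refine ⟨a, k 2 • b + k 1 • a, k 2 • c - k 0 • a,
      hgen.trans (sup_le (Submodule.span_le.2 ?_) le_sup_right), ?_⟩
    · set S := Submodule.span F {a, k 2 • b + k 1 • a, k 2 • c - k 0 • a}
      have ma : a ∈ S := Submodule.subset_span (by simp)
      have mb : k 2 • b + k 1 • a ∈ S := Submodule.subset_span (by simp)
      have mc : k 2 • c - k 0 • a ∈ S := Submodule.subset_span (by simp)
      rintro _ (rfl | rfl | rfl)
      · exact Submodule.mem_sup_left ma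
      · exact Submodule.mem_sup_left ((Submodule.smul_mem_iff _ k2).1
          ((Submodule.add_mem_iff_left _ (Submodule.smul_mem _ _ ma)).1 mb))
      · exact Submodule.mem_sup_left ((Submodule.smul_mem_iff _ k2).1
          ((Submodule.sub_mem_iff_left _ (Submodule.smul_mem _ _ ma)).1 mc))
    · have e : (k 2 • b + k 1 • a) * (k 2 • c - k 0 • a) =
          k 2 • (k 0 • (a * b) + k 1 • (a * c) + k 2 • (b * c)) := by
        simp only [mul_sub, add_mul, smul_mul_assoc, mul_smul_comm, h.mul_self h2, h b a]
        module
      rw [e]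
      exact Submodule.smul_mem _ _ hrel

/-- Modulo the central L_m, L_n is a line, and squares vanish. -/
theorem mul_eq_zero_of_finrank_le (h : IsAnticommutative A) (h2 : (2 : F) ≠ 0) {n m k : ℕ}
    (hm : n + 1 = m) (hk : m + 1 = k) (hlt : lowerCentral F A m < lowerCentral F A n)
    (hr : Module.finrank F (lowerCentral F A n) ≤ Module.finrank F (lowerCentral F A m) + 1)
    (hn : lowerCentral F A k = ⊥) :
    ∀ x ∈ lowerCentral F A n, ∀ y ∈ lowerCentral F A n, x * y = 0 := by
  subst hm hk
  obtain ⟨v, hv, hv'⟩ := Set.exists_of_ssubset hlt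
  have hline := le_span_singleton_sup_of_finrank_le hlt.le hr hv hv'
  intro x hx y hy
  refine mul_mem_of_le_span_sup (K := ⊥) hline hline ?_
    (fun x _ y hy => mul_eq_zero_of_lowerCentral hn x hy)
    (fun x hx y _ => h.mul_eq_zero_of_lowerCentral hn y hx)
    (fun x hx y _ => h.mul_eq_zero_of_lowerCentral hn y hx) hx hy
  rintro _ rfl _ rfl
  exact h.mul_self h2 _

end Adapted

/-! ### The possible dimension sequences. -/

section Classification

variable {F : Type*} [Field F] {A : Type*} [NonUnitalNonAssocRing A] [Module F A]
  [IsScalarTower F A A] [SMulCommClass F A A]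

/-- L_1 L_1 vanishes if L_1 is a line modulo L_2, and also if two generators suffice, since it then
lies in L_3 = 0. Hence dim L_2 + 2 ≤ dim L_1 ≤ 3 with L_2 ≠ 0. -/
theorem finrank_lowerCentral_of_mul_ne_zero (h : IsAnticommutative A) (h2 : (2 : F) ≠ 0)
    (hdim : Module.finrank F A = 6) (hnil : IsNilpotentAlgebra F A)
    (h3 : lowerCentral F A 3 = ⊥)
    (h11 : ¬ ∀ x ∈ lowerCentral F A 1, ∀ y ∈ lowerCentral F A 1, x * y = 0) :
    Module.finrank F (lowerCentral F A 1) = 3 ∧ Module.finrank F (lowerCentral F A 2) = 1 := by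
  have : FiniteDimensional F A := Module.finite_of_finrank_pos (by omega)
  have hn2 : lowerCentral F A 2 ≠ ⊥ := fun hbot =>
    h11 fun x _ y hy => mul_eq_zero_of_lowerCentral hbot x hy
  have hn1 : lowerCentral F A 1 ≠ ⊥ := fun hbot =>
    hn2 (le_bot_iff.1 ((lowerCentral_succ_le 1).trans hbot.le))
  have l1 := lowerCentral_succ_lt hnil hn1
  have r2 : 0 < Module.finrank F (lowerCentral F A 2) :=
    Nat.pos_of_ne_zero fun h0 => hn2 (Submodule.finrank_eq_zero.1 h0)
  have r1 : Module.finrank F (lowerCentral F A 2) + 2 ≤ Module.finrank F (lowerCentral F A 1) := by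
    by_contra hr
    exact h11 (mul_eq_zero_of_finrank_le (m := 2) h h2 rfl rfl l1 (by omega) h3)
  have r1' : Module.finrank F (lowerCentral F A 1) ≤ 3 := by
    by_contra hr
    obtain ⟨a, b, hgen⟩ := exists_two_generators (F := F) (A := A) (by omega)
    refine h11 fun x hx y hy => ?_
    have := mul_mem_lowerCentral_three h h2 (lowerCentral_one_le_of_two h h2 hgen) hx hy
    rwa [h3] at this
  omega

theorem exists_algebrasIsomorphic_B61 (h : IsAnticommutative A) (h2 : (2 : F) ≠ 0)
    (hdim : Module.finrank F A = 6) (hnil : IsNilpotentAlgebra F A)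
    (h3 : lowerCentral F A 3 = ⊥)
    (h11 : ¬ ∀ x ∈ lowerCentral F A 1, ∀ y ∈ lowerCentral F A 1, x * y = 0) :
    ∃ α : F, AlgebrasIsomorphic F A (B61 α) := by
  have : FiniteDimensional F A := Module.finite_of_finrank_pos (by omega)
  obtain ⟨r1, r2⟩ := finrank_lowerCentral_of_mul_ne_zero h h2 hdim hnil h3 h11
  obtain ⟨a, b, c, hgen, hbc⟩ := exists_three_generators_mul_mem (F := F) h h2
    (by omega) (by omega) (fun hbot => by rw [hbot, finrank_bot] at r2; omega)
  refine algebrasIsomorphic_B61_of_mul_mem h h2 hdim hgen hbc h3 (fun v hv hv0 => ?_) ?_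
  · have := le_span_singleton_sup_of_finrank_le (U := ⊥) bot_le (by rw [r2]; omega) hv
      (by simpa using hv0)
    rwa [sup_bot_eq] at this
  · push Not at h11
    exact h11

/-- Nilpotent algebras of dimension six and class at least four. -/
theorem jacobian_eq_zero_of_lowerCentral_three_ne_bot (h2 : (2 : F) ≠ 0)
    (hdim : Module.finrank F A = 6) (hnil : IsNilpotentAlgebra F A)
    (h3 : lowerCentral F A 3 ≠ ⊥) (h : IsAnticommutative A) :
    (IsCDAlgebra F A → ∀ w ∈ lowerCentral F A 1, ∀ x y, jacobian w x y = 0) ∧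
    (IsMalcevAlgebra A → (∀ w ∈ lowerCentral F A 1, ∀ x y, jacobian w x y = 0) ∧
      ∀ x y z w : A, jacobian x y z * w = 0) := by
  have : FiniteDimensional F A := Module.finite_of_finrank_pos (by omega)
  have up : ∀ n, lowerCentral F A (n + 1) ≠ ⊥ → lowerCentral F A n ≠ ⊥ := fun n hn hbot =>
    hn (le_bot_iff.1 ((lowerCentral_succ_le n).trans hbot.le))
  have rlt : ∀ n m, n + 1 = m → lowerCentral F A n ≠ ⊥ → Module.finrank F (lowerCentral F A m) <
      Module.finrank F (lowerCentral F A n) := by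
    rintro n _ rfl hn
    exact Submodule.finrank_lt_finrank_of_lt (lowerCentral_succ_lt hnil hn)
  have n2 := up 2 h3
  have n1 := up 1 n2
  have s1 := rlt 1 2 rfl n1
  have s2 := rlt 2 3 rfl n2
  have s3 := rlt 3 4 rfl h3
  have r1 := finrank_lowerCentral_one_add_two_le (F := F) h h2 (lowerCentral_succ_lt hnil n1)
  -- Strict descent and the bound on generators leave dim L_1 equal to 3 or 4; the value 3 forces
  -- dimensions 3, 2, 1, 0 for L_1, ..., L_4.
  by_cases hr : Module.finrank F (lowerCentral F A 1) = 3
  · have h4 : lowerCentral F A 4 = ⊥ := Submodule.finrank_eq_zero.1 (by omega)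
    obtain ⟨a, b, c, hgen, hu, hac, hbc⟩ := exists_adapted_three_generators (F := F) h h2
      (by omega) (by omega) (lowerCentral_succ_lt hnil n1)
    have h22 := mul_eq_zero_of_finrank_le (m := 3) h h2 rfl rfl (lowerCentral_succ_lt hnil n2)
      (by omega) h4
    refine ⟨fun hcd => hcd.jacobian_eq_zero_of_three h h2 hgen hu hac hbc h4 h22,
      fun hM => hM.jacobian_eq_zero_of_three h2 hgen hu hac hbc h3 h4 (fun v hv hv3 => ?_) h22⟩
    exact le_span_singleton_sup_of_finrank_le (U := lowerCentral F A 3) (lowerCentral_succ_le 2)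
      (by omega) hv hv3
  · suffices hJ : IsCDAlgebra F A ∨ IsMalcevAlgebra A → ∀ x y z : A, jacobian x y z = 0 from
      ⟨fun hcd w _ x y => hJ (Or.inl hcd) w x y, fun hM => ⟨fun w _ x y => hJ (Or.inr hM) w x y,
        fun x y z w => by rw [hJ (Or.inr hM), zero_mul]⟩⟩
    by_cases h4 : lowerCentral F A 4 = ⊥
    · obtain ⟨a, b, hgen⟩ := exists_two_generators (F := F) (A := A) (by omega)
      rintro (hcd | hM)
      · exact hcd.jacobian_eq_zero_of_lowerCentral_four h h2 hgen h4
      · exact hM.jacobian_eq_zero_of_lowerCentral_four h2 hgen h4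
    -- Four strict drops below dimension 4 force dimensions 4, 3, 2, 1, 0 for L_1, ..., L_5.
    · have s4 := rlt 4 5 rfl h4
      have h5 : lowerCentral F A 5 = ⊥ := Submodule.finrank_eq_zero.1 (by omega)
      obtain ⟨a, b, hgen, hv, hbu⟩ := exists_adapted_two_generators (F := F) h h2 (by omega)
        (by omega) (lowerCentral_succ_lt hnil n2)
      rintro (hcd | hM)
      · exact hcd.jacobian_eq_zero_of_lowerCentral_five h h2 hgen hv hbu
          (mul_eq_zero_of_finrank_le (m := 4) h h2 rfl rfl (lowerCentral_succ_lt hnil h3)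
            (by omega) h5) h5
      · exact hM.jacobian_eq_zero_of_lowerCentral_five h2 hgen hv hbu h5

end Classification

theorem mainTheorem5 (F : Type*) [Field F] (hF : ringChar F ≠ 2)
    (A : Type*) [NonUnitalNonAssocRing A] [Module F A]
    [IsScalarTower F A A] [SMulCommClass F A A]
    (hdim : Module.finrank F A = 6) (hnil : IsNilpotentAlgebra F A) :
    (IsAnticommutative A → IsCDAlgebra F A →
      IsMalcevAlgebra A ∨ ∃ α : F, AlgebrasIsomorphic F A (B61 α)) ∧
    (IsMalcevAlgebra A → IsCDAlgebra F A) := by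
  have h2 : (2 : F) ≠ 0 := Ring.two_ne_zero hF
  have : FiniteDimensional F A := Module.finite_of_finrank_pos (by omega)
  by_cases h3 : lowerCentral F A 3 = ⊥
  · by_cases h11 : ∀ x ∈ lowerCentral F A 1, ∀ y ∈ lowerCentral F A 1, x * y = 0
    · refine ⟨fun h hcd => Or.inl (.of_isCDAlgebra h h2 hcd
        (jacobian_eq_zero_of_lowerCentral_three_eq_bot h h3 h11).1), fun hM => ?_⟩
      have hJ := jacobian_eq_zero_of_lowerCentral_three_eq_bot hM.anticommutative h3 h11
      exact .of_jacobian hM.anticommutative hJ.1 hJ.2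
    · refine ⟨fun h _ => Or.inr (exists_algebrasIsomorphic_B61 h h2 hdim hnil h3 h11),
        fun hM => absurd ?_ h11⟩
      obtain ⟨r1, -⟩ := finrank_lowerCentral_of_mul_ne_zero hM.anticommutative h2 hdim hnil h3 h11
      obtain ⟨a, b, c, hgen⟩ := exists_three_generators (F := F) (A := A) (by omega)
      exact hM.mul_lowerCentral_one_eq_zero h2 hgen h3
  · refine ⟨fun h hcd => Or.inl (.of_isCDAlgebra h h2 hcd
      ((jacobian_eq_zero_of_lowerCentral_three_ne_bot h2 hdim hnil h3 h).1 hcd)), fun hM => ?_⟩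
    have hJ := (jacobian_eq_zero_of_lowerCentral_three_ne_bot h2 hdim hnil h3
      hM.anticommutative).2 hM
    exact .of_jacobian hM.anticommutative hJ.1 hJ.2
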